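/- Let $(M,g)$ be a smooth real $4$-manifold with a metric of arbitrary signature and a spin structure, so that $TM\otimes\mathbb{C}\cong\mathbb{S}\otimes\mathbb{S}'$, $v^a=v^{AA'}$, $g_{ab}=\epsilon_{AB}\epsilon_{A'B'}$; indices are moved by $\varphi^A=\epsilon^{AB}\varphi_B$, $\varphi_A=\epsilon_{BA}\varphi^B$, and $\nabla_{AA'}$ is the Levi-Civita (spin) connection. Let $\alpha^A,\beta^A$ be smooth (complex) spinor fields with $\phi:=\alpha_A\beta^A$ nowhere zero, let $$K^a{}_b=\phi^{-1}(\alpha^A\beta_B+\beta^A\alpha_B)\delta^{A'}{}_{B'}$$ be the almost para-Hermitian structure they represent, with fundamental form $\omega(X,Y)=g(KX,Y)$ and Lee form $f_a=\tfrac14\omega^{bc}(d\omega)_{abc}$. For real numbers $w_0,w_1$ put $$L_{AA'}=\phi^{-1}\beta_B\nabla_{AA'}\alpha^B+\phi^{-1}\beta_A f_{A'B}\alpha^B-w_0f_{AA'},\qquad M_{AA'}=-\phi^{-1}\alpha_B\nabla_{AA'}\beta^B-\phi^{-1}\alpha_A f_{A'B}\beta^B-w_1f_{AA'},$$ and for a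 scalar field $h$ of type $(r,r';w)$ put $\mathcal{C}_{AA'}h=\partial_{AA'}h+(wf_{AA'}+rL_{AA'}+r'M_{AA'})h$, $\ \mathcal{C}_{A'}=\beta^A\mathcal{C}_{AA'}$, $\ \tilde{\mathcal{C}}_{A'}=\alpha^A\mathcal{C}_{AA'}$. For a smooth complex scalar field $\varepsilon$, regarded as having type $(-1,1;w_1-w_0)$ (so that $\varepsilon^2$ has type $(-2,2;2(w_1-w_0))$), put $\beta_\varepsilon^A=\beta^A+\varepsilon\alpha^A$, let $K_\varepsilon$ be the endomorphism field represented by $\alpha^A,\beta_\varepsilon^A$ (the $B$-transformation of $K$ with parameter $\varepsilon$), and let $L_\varepsilon=\{\beta_\varepsilon^A\nu^{A'}\}$ be its $(+1)$-eigenbundle. Then: 1. For every $\varepsilon$, $$\beta_\varepsilon^A\beta_\varepsilon^B\nabla_{AA'}\beta_{\varepsilon B}=\beta^A\beta^B\nabla_{AA'}\beta_B+\phi\,\mathcal{C}_{A'}\varepsilon+\tfrac12\phi\,\tilde{\mathcal{C}}_{A'}\varepsilon^2+(\alpha^A\alpha^B\nabla_{AA'}\alpha_B)\,\varepsilon^3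 .$$ 2. For every $\varepsilon$, $L_\varepsilon$ is involutive (closed under the Lie bracket of smooth sections) if and only if $\beta_\varepsilon^A\beta_\varepsilon^B\nabla_{AA'}\beta_{\varepsilon B}=0$. In particular ($\varepsilon=0$), $L$ is involutive if and only if $\beta^A$ is shear-free. 3. Suppose that $\beta^A$ is shear-free, $\beta^A\beta^B\nabla_{AA'}\beta_B=0$ (so $(g,K)$ is half-integrable). Let $\varepsilon_t$, $t\in\mathbb{R}$, be a family of scalar fields, smooth in $(t,x)$, with $\varepsilon_0=0$ and first-order part $\dot\varepsilon=\partial_t\varepsilon_t|_{t=0}$ (for instance $\varepsilon_t=t\varepsilon$, $\dot\varepsilon=\varepsilon$), let $K_t=K_{\varepsilon_t}$, and let $P_t=\tfrac12(1+K_t)$, $\tilde P_t=\tfrac12(1-K_t)$. Then the eigenbundle $L_t$ of $K_t$ is involutive to first order, meaning that at every point $\tilde P_t[P_tX,P_tY]$ vanishes at $t=0$ and is $o(t)$ as $t\to0$ for all smooth complex vector fields $X,Y$, if and only if $\mathcal{C}_{A'}\dot\varepsilon=0$. -/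

import Mathlib

open scoped Manifold ContDiff Topology

noncomputable section

namespace ParaHermitian

/-! ### Complexified tangent vectors -/

/-- The complexification of a real vector space, as the type of formal sums `re + i im`. -/
@[ext] structure Cplx (V : Type*) where
  re : V
  im : V

namespace Cplx

variable {V : Type*} [AddCommGroup V]

instance : Zero (Cplx V) := ⟨⟨0, 0⟩⟩
instance : Add (Cplx V) := ⟨fun X Y => ⟨X.re + Y.re, X.im + Y.im⟩⟩
instance : Neg (Cplx V) := ⟨fun X => ⟨-X.re, -X.im⟩⟩

@[simp] lemma zero_re : (0 : Cplx V).re = 0 := rfl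
@[simp] lemma zero_im : (0 : Cplx V).im = 0 := rfl
@[simp] lemma add_re (X Y : Cplx V) : (X + Y).re = X.re + Y.re := rfl
@[simp] lemma add_im (X Y : Cplx V) : (X + Y).im = X.im + Y.im := rfl
@[simp] lemma neg_re (X : Cplx V) : (-X).re = -X.re := rfl
@[simp] lemma neg_im (X : Cplx V) : (-X).im = -X.im := rfl

instance : AddCommGroup (Cplx V) where
  add_assoc X Y Z := by ext <;> simp [add_assoc]
  zero_add X := by ext <;> simp
  add_zero X := by ext <;> simp
  neg_add_cancel X := by ext <;> simp
  add_comm X Y := by ext <;> simp [add_comm]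
  nsmul := nsmulRec
  zsmul := zsmulRec

variable [Module ℝ V]

instance : SMul ℂ (Cplx V) :=
  ⟨fun z X => ⟨z.re • X.re - z.im • X.im, z.re • X.im + z.im • X.re⟩⟩

@[simp] lemma smul_re (z : ℂ) (X : Cplx V) : (z • X).re = z.re • X.re - z.im • X.im := rfl
@[simp] lemma smul_im (z : ℂ) (X : Cplx V) : (z • X).im = z.re • X.im + z.im • X.re := rfl

instance : Module ℂ (Cplx V) where
  one_smul X := by ext <;> simp
  mul_smul z w X := by ext <;> simp <;> module
  smul_zero z := by ext <;> simp
  smul_add z X Y := by ext <;> simp <;> module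
  add_smul z w X := by ext <;> simp <;> module
  zero_smul X := by ext <;> simp

end Cplx

instance {V : Type*} [TopologicalSpace V] : TopologicalSpace (Cplx V) :=
  TopologicalSpace.induced (fun X : Cplx V => (X.re, X.im)) inferInstance

variable {M : Type*} [TopologicalSpace M] [ChartedSpace (EuclideanSpace ℝ (Fin 4)) M]

/-- The fibre of `TM ⊗ ℂ` at `x`. -/
abbrev CTangent (x : M) : Type := Cplx (TangentSpace (𝓡 4) x)

/-- The derivative of a complex function along a complex tangent vector. -/
def cderiv (f : M → ℂ) (x : M) (v : CTangent x) : ℂ :=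
  let df : TangentSpace (𝓡 4) x →L[ℝ] ℂ := mfderiv (𝓡 4) 𝓘(ℝ, ℂ) f x
  df v.re + Complex.I * df v.im

/-- The `ℂ`-bilinear extension of the Lie bracket to complex vector fields. -/
def cbracket (X Y : ∀ x : M, CTangent x) (x : M) : CTangent x where
  re := VectorField.mlieBracket (𝓡 4) (fun y => (X y).re) (fun y => (Y y).re) x
    - VectorField.mlieBracket (𝓡 4) (fun y => (X y).im) (fun y => (Y y).im) x
  im := VectorField.mlieBracket (𝓡 4) (fun y => (X y).re) (fun y => (Y y).im) x
    + VectorField.mlieBracket (𝓡 4) (fun y => (X y).im) (fun y => (Y y).re) x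

/-- A smooth complex-valued function on `M`. -/
def SmoothFun (f : M → ℂ) : Prop := ContMDiff (𝓡 4) 𝓘(ℝ, ℂ) ∞ f

/-- The exterior derivative of a complex 2-form, evaluated on complex vector fields. -/
def extDerivTwo (Ω : ∀ x : M, CTangent x → CTangent x → ℂ) (X Y Z : ∀ x : M, CTangent x)
    (x : M) : ℂ :=
  cderiv (fun y => Ω y (Y y) (Z y)) x (X x) + cderiv (fun y => Ω y (Z y) (X y)) x (Y x)
    + cderiv (fun y => Ω y (X y) (Y y)) x (Z x)
    - Ω x (cbracket X Y x) (Z x) - Ω x (cbracket Y Z x) (X x) - Ω x (cbracket Z X x) (Y x)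

section Geometry

variable [IsManifold (𝓡 4) ∞ M]

/-- A complex vector field is smooth on `U` if its real and imaginary parts are. -/
def SmoothOn (X : ∀ x : M, CTangent x) (U : Set M) : Prop :=
  ContMDiffOn (𝓡 4) (𝓡 4).tangent ∞ (fun x => (⟨x, (X x).re⟩ : TangentBundle (𝓡 4) M)) U ∧
  ContMDiffOn (𝓡 4) (𝓡 4).tangent ∞ (fun x => (⟨x, (X x).im⟩ : TangentBundle (𝓡 4) M)) U

variable (M) in
/-- A smooth metric of arbitrary signature. -/
structure PseudoMetric where
  val (x : M) : TangentSpace (𝓡 4) x →L[ℝ] TangentSpace (𝓡 4) x →L[ℝ] ℝ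
  symm (x : M) (v w : TangentSpace (𝓡 4) x) : val x v w = val x w v
  nondegenerate (x : M) (v : TangentSpace (𝓡 4) x) (hv : ∀ w, val x v w = 0) : v = 0
  smooth : ContMDiff (𝓡 4) ((𝓡 4).prod
      𝓘(ℝ, EuclideanSpace ℝ (Fin 4) →L[ℝ] EuclideanSpace ℝ (Fin 4) →L[ℝ] ℝ)) ∞
    (fun x => Bundle.TotalSpace.mk'
      (EuclideanSpace ℝ (Fin 4) →L[ℝ] EuclideanSpace ℝ (Fin 4) →L[ℝ] ℝ)
      (E := fun x : M => TangentSpace (𝓡 4) x →L[ℝ] TangentSpace (𝓡 4) x →L[ℝ] ℝ) x (val x))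

/-- The `ℂ`-bilinear extension of the metric. -/
def PseudoMetric.c (g : PseudoMetric M) (x : M) (v w : CTangent x) : ℂ :=
  ((g.val x v.re w.re - g.val x v.im w.im : ℝ) : ℂ)
    + Complex.I * ((g.val x v.re w.im + g.val x v.im w.re : ℝ) : ℂ)

/-- `g(∇_X Y, Z)` for the Levi-Civita connection `∇` of `g` (Koszul formula). -/
def PseudoMetric.leviCivita (g : PseudoMetric M) (X Y Z : ∀ x : M, CTangent x) (x : M) : ℂ :=
  (1 / 2 : ℂ) *
    (cderiv (fun y => g.c y (Y y) (Z y)) x (X x) + cderiv (fun y => g.c y (Z y) (X y)) x (Y x)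
      - cderiv (fun y => g.c y (X y) (Y y)) x (Z x)
      + g.c x (cbracket X Y x) (Z x) - g.c x (cbracket Y Z x) (X x)
      + g.c x (cbracket Z X x) (Y x))

/-! ### Endomorphisms of `TM ⊗ ℂ` -/

/-- The `+1`-eigenbundle of `K` is involutive: it is closed under brackets of smooth sections. -/
def Involutive (K : ∀ x : M, CTangent x →ₗ[ℂ] CTangent x) : Prop :=
  ∀ X Y : ∀ x : M, CTangent x, SmoothOn X Set.univ → SmoothOn Y Set.univ →
    (∀ x, K x (X x) = X x) → (∀ x, K x (Y x) = Y x) →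
    ∀ x, K x (cbracket X Y x) = cbracket X Y x

/-- The projector `P = (1 + K) / 2` applied to a vector field. -/
def projPlus (K : ∀ x : M, CTangent x →ₗ[ℂ] CTangent x) (X : ∀ x : M, CTangent x) (x : M) :
    CTangent x :=
  (1 / 2 : ℂ) • (X x + K x (X x))

/-- The projector `P̃ = (1 - K) / 2` applied to a vector field. -/
def projMinus (K : ∀ x : M, CTangent x →ₗ[ℂ] CTangent x) (X : ∀ x : M, CTangent x) (x : M) :
    CTangent x :=
  (1 / 2 : ℂ) • (X x + -(K x (X x)))

/-- `N_P(X, Y) = P̃ [P X, P Y]`, the obstruction to involutivity of the `+1`-eigenbundle. -/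
def nijenhuisPlus (K : ∀ x : M, CTangent x →ₗ[ℂ] CTangent x) (X Y : ∀ x : M, CTangent x)
    (x : M) : CTangent x :=
  projMinus K (cbracket (projPlus K X) (projPlus K Y)) x

/-- For a family `K t` with `+1`-eigenbundles `L t`: the bundle `L t` is involutive to first
order in `t`, that is, the obstruction `N_P` of `K t` vanishes at `t = 0` and is `o(t)`. -/
def InvolutiveToFirstOrder (K : ℝ → ∀ x : M, CTangent x →ₗ[ℂ] CTangent x) : Prop :=
  ∀ X Y : ∀ x : M, CTangent x, SmoothOn X Set.univ → SmoothOn Y Set.univ → ∀ x : M,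
    nijenhuisPlus (K 0) X Y x = 0 ∧
    Filter.Tendsto (fun t : ℝ => ((t⁻¹ : ℝ) : ℂ) • nijenhuisPlus (K t) X Y x)
      (𝓝[≠] 0) (𝓝 0)

/-! ### Spin structures and spinor fields -/

/-- The components `ε₀₁ = 1 = -ε₁₀` of the spin-space symplectic forms `ε_{AB}`, `ε_{A'B'}`; the
inverses `ε^{AB}`, `ε^{A'B'}` (with `ε^{AC} ε_{BC} = δ^A_B`) have the same components. -/
def eps (A B : Fin 2) : ℂ := if A = B then 0 else if A = 0 then 1 else -1

/-- Components `g_{ab} = ε_{AB} ε_{A'B'}` of the metric, with `a = (A, A')`; the inverse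
`g^{ab}` has the same components. -/
def eta (a b : Fin 2 × Fin 2) : ℂ := eps a.1 b.1 * eps a.2 b.2

/-- A (complex) spin structure of `(M, g)`, given by an atlas of spin frames: over each open set
`U i` the pair of local symplectic frames `o_A`, `o'_{A'}` of the two spin bundles is recorded by
the null tetrad `e i (A, A') = o_A ⊗ o'_{A'}` of `TM ⊗ ℂ`, and over overlaps the spin frames are
related by `SL(2, ℂ) × SL(2, ℂ)`-valued cocycles `trans`, `trans'`. A spin structure in Riemannian,
Lorentzian or split signature gives one by extension of the structure group
to `SL(2, ℂ) × SL(2, ℂ)`. -/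
structure SpinStructure (g : PseudoMetric M) (ι : Type*) where
  U : ι → Set M
  isOpen (i : ι) : IsOpen (U i)
  cover (x : M) : ∃ i, x ∈ U i
  e : ι → Fin 2 × Fin 2 → ∀ x : M, CTangent x
  smooth_e (i : ι) (a : Fin 2 × Fin 2) : SmoothOn (e i a) (U i)
  metric_e (i : ι) (a b : Fin 2 × Fin 2) (x : M) (hx : x ∈ U i) :
    g.c x (e i a x) (e i b x) = eta a b
  trans : ι → ι → M → Matrix (Fin 2) (Fin 2) ℂ
  trans' : ι → ι → M → Matrix (Fin 2) (Fin 2) ℂ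
  smooth_trans (i j : ι) (A B : Fin 2) :
    ContMDiffOn (𝓡 4) 𝓘(ℝ, ℂ) ∞ (fun x => trans i j x A B) (U i ∩ U j)
  smooth_trans' (i j : ι) (A B : Fin 2) :
    ContMDiffOn (𝓡 4) 𝓘(ℝ, ℂ) ∞ (fun x => trans' i j x A B) (U i ∩ U j)
  det_trans (i j : ι) (x : M) (hi : x ∈ U i) (hj : x ∈ U j) : (trans i j x).det = 1
  det_trans' (i j : ι) (x : M) (hi : x ∈ U i) (hj : x ∈ U j) : (trans' i j x).det = 1
  cocycle (i j k : ι) (x : M) (hi : x ∈ U i) (hj : x ∈ U j) (hk : x ∈ U k) :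
    trans i k x = trans i j x * trans j k x
  cocycle' (i j k : ι) (x : M) (hi : x ∈ U i) (hj : x ∈ U j) (hk : x ∈ U k) :
    trans' i k x = trans' i j x * trans' j k x
  trans_e (i j : ι) (b : Fin 2 × Fin 2) (x : M) (hi : x ∈ U i) (hj : x ∈ U j) :
    e j b x = ∑ a : Fin 2 × Fin 2, (trans i j x a.1 b.1 * trans' i j x a.2 b.2) • e i a x

/-- `α_A β^A = ε_{BA} α^B β^A`, for the components of two spinors. -/
def contract (α β : Fin 2 → ℂ) : ℂ := ∑ A, ∑ B, eps B A * α B * β A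

/-- The lowered components `φ_A = ε_{BA} φ^B`. -/
def lower (φ : Fin 2 → ℂ) (A : Fin 2) : ℂ := ∑ B, eps B A * φ B

/-- The components of `β_ε^A = β^A + ε α^A` in every spin frame. -/
def deform {ι : Type*} (α β : ι → M → Fin 2 → ℂ) (ε : M → ℂ) (i : ι) (x : M) (A : Fin 2) : ℂ :=
  β i x A + ε x * α i x A

namespace SpinStructure

variable {g : PseudoMetric M} {ι : Type*} (S : SpinStructure g ι)

/-- A smooth unprimed spinor field `φ^A`, given by its components in the spin frames. -/
structure IsSpinorField (φ : ι → M → Fin 2 → ℂ) : Prop where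
  smooth (i : ι) (A : Fin 2) : ContMDiffOn (𝓡 4) 𝓘(ℝ, ℂ) ∞ (fun x => φ i x A) (S.U i)
  trans (i j : ι) (x : M) (hi : x ∈ S.U i) (hj : x ∈ S.U j) (A : Fin 2) :
    φ i x A = ∑ B, S.trans i j x A B * φ j x B

/-- The components `v^{AA'} = g^{ab} v_b` of a complex tangent vector. -/
def coord (i : ι) (x : M) (v : CTangent x) (a : Fin 2 × Fin 2) : ℂ :=
  ∑ b : Fin 2 × Fin 2, eta a b * g.c x v (S.e i b x)

/-- `K^a_b = φ⁻¹ (α^A β_B + β^A α_B) δ^{A'}_{B'}` with `φ = α_A β^A`: the endomorphism field `K`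
is represented by the spinor fields `α`, `β`. -/
def Represents (K : ∀ x : M, CTangent x →ₗ[ℂ] CTangent x) (α β : ι → M → Fin 2 → ℂ) : Prop :=
  ∀ (i : ι), ∀ x ∈ S.U i, ∀ v : CTangent x,
    K x v = ∑ a : Fin 2 × Fin 2, ((contract (α i x) (β i x))⁻¹ *
      ∑ B, (α i x a.1 * lower (β i x) B + β i x a.1 * lower (α i x) B) * S.coord i x v (B, a.2)) •
        S.e i a x

/-- The coefficients of the Levi-Civita spin connection in a spin frame,
`∇_a o_B = γ_{aB}{}^D o_D` with `γ_{aB}{}^D = ½ ε^{DC} ε^{B'C'} g(∇_a e_{BB'}, e_{CC'})`. -/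
def spinCoeff (i : ι) (a : Fin 2 × Fin 2) (B D : Fin 2) (x : M) : ℂ :=
  (1 / 2 : ℂ) * ∑ C : Fin 2, ∑ B' : Fin 2, ∑ C' : Fin 2,
    eps D C * eps B' C' * g.leviCivita (S.e i a) (S.e i (B, B')) (S.e i (C, C')) x

/-- `∇_{AA'} φ^C` in the `i`-th spin frame, with `a = (A, A')`. -/
def nabla (i : ι) (φ : M → Fin 2 → ℂ) (a : Fin 2 × Fin 2) (C : Fin 2) (x : M) : ℂ :=
  cderiv (fun y => φ y C) x (S.e i a x) + ∑ B, S.spinCoeff i a B C x * φ x B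

/-- The shear `φ^A φ^B ∇_{AA'} φ_B = φ^A φ^B ε_{CB} ∇_{AA'} φ^C`. -/
def shear (i : ι) (φ : M → Fin 2 → ℂ) (A' : Fin 2) (x : M) : ℂ :=
  ∑ A, ∑ B, ∑ C, φ x A * φ x B * eps C B * S.nabla i φ (A, A') C x

/-- The shear-free condition `φ^A φ^B ∇_{AA'} φ_B = 0`. -/
def ShearFree (φ : ι → M → Fin 2 → ℂ) : Prop :=
  ∀ (i : ι), ∀ x ∈ S.U i, ∀ A' : Fin 2, S.shear i (φ i) A' x = 0

variable (g) in
/-- The fundamental 2-form `ω(X, Y) = g(K X, Y)`. -/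
def fundForm (K : ∀ x : M, CTangent x →ₗ[ℂ] CTangent x) (x : M) (v w : CTangent x) : ℂ :=
  g.c x (K x v) w

/-- The Lee form `f_a = ¼ ω^{bc} (dω)_{abc}` of `(g, K)` in dimension four. -/
def lee (K : ∀ x : M, CTangent x →ₗ[ℂ] CTangent x) (i : ι) (a : Fin 2 × Fin 2) (x : M) : ℂ :=
  (1 / 4 : ℂ) * ∑ b : Fin 2 × Fin 2, ∑ c : Fin 2 × Fin 2,
    (∑ d : Fin 2 × Fin 2, ∑ h : Fin 2 × Fin 2,
      eta b d * eta c h * fundForm g K x (S.e i d x) (S.e i h x)) *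
    extDerivTwo (fundForm g K) (S.e i a) (S.e i b) (S.e i c) x

/-- `L_{AA'} = φ⁻¹ β_B ∇_{AA'} α^B + φ⁻¹ β_A f_{A'B} α^B - w₀ f_{AA'}`. -/
def connL (K : ∀ x : M, CTangent x →ₗ[ℂ] CTangent x) (α β : ι → M → Fin 2 → ℂ) (w₀ : ℝ)
    (i : ι) (a : Fin 2 × Fin 2) (x : M) : ℂ :=
  (contract (α i x) (β i x))⁻¹ * ∑ B, lower (β i x) B * S.nabla i (α i) a B x
    + (contract (α i x) (β i x))⁻¹ * lower (β i x) a.1 *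
        ∑ B, S.lee K i (B, a.2) x * α i x B
    - w₀ * S.lee K i a x

/-- `M_{AA'} = -φ⁻¹ α_B ∇_{AA'} β^B - φ⁻¹ α_A f_{A'B} β^B - w₁ f_{AA'}`. -/
def connM (K : ∀ x : M, CTangent x →ₗ[ℂ] CTangent x) (α β : ι → M → Fin 2 → ℂ) (w₁ : ℝ)
    (i : ι) (a : Fin 2 × Fin 2) (x : M) : ℂ :=
  -((contract (α i x) (β i x))⁻¹ * ∑ B, lower (α i x) B * S.nabla i (β i) a B x)
    - (contract (α i x) (β i x))⁻¹ * lower (α i x) a.1 *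
        ∑ B, S.lee K i (B, a.2) x * β i x B
    - w₁ * S.lee K i a x

/-- The covariant derivative `C_{AA'} f = ∂_{AA'} f + (w f_{AA'} + r L_{AA'} + r' M_{AA'}) f` of a
scalar field `f` of type `(r, r'; w)`. -/
def weightedDeriv (K : ∀ x : M, CTangent x →ₗ[ℂ] CTangent x) (α β : ι → M → Fin 2 → ℂ)
    (w₀ w₁ r r' w : ℝ) (i : ι) (f : M → ℂ) (a : Fin 2 × Fin 2) (x : M) : ℂ :=
  cderiv f x (S.e i a x)
    + (w * S.lee K i a x + r * S.connL K α β w₀ i a x + r' * S.connM K α β w₁ i a x) * f x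

/-- `C_{A'} f = β^A C_{AA'} f` for a scalar field `f` of type `(r, r'; w)`. -/
def weightedDerivβ (K : ∀ x : M, CTangent x →ₗ[ℂ] CTangent x) (α β : ι → M → Fin 2 → ℂ)
    (w₀ w₁ r r' w : ℝ) (i : ι) (f : M → ℂ) (A' : Fin 2) (x : M) : ℂ :=
  ∑ A, β i x A * S.weightedDeriv K α β w₀ w₁ r r' w i f (A, A') x

/-- `C̃_{A'} f = α^A C_{AA'} f` for a scalar field `f` of type `(r, r'; w)`. -/
def weightedDerivα (K : ∀ x : M, CTangent x →ₗ[ℂ] CTangent x) (α β : ι → M → Fin 2 → ℂ)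
    (w₀ w₁ r r' w : ℝ) (i : ι) (f : M → ℂ) (A' : Fin 2) (x : M) : ℂ :=
  ∑ A, α i x A * S.weightedDeriv K α β w₀ w₁ r r' w i f (A, A') x

end SpinStructure

end Geometry

end ParaHermitian

end

/-!
Everything is reduced to pointwise algebra in a null tetrad `e_{AA'}`, whose Gram matrix is
constant. The Koszul formula then says that the coefficients `Γ_{abc} = g(∇_a e_b, e_c)` are skew in
`b, c` (`conn_antisymm`) and that `g([e_a, e_b], e_c) = Γ_{abc} - Γ_{bac}` (`c_cbracket_e`); nothing
else about the Levi-Civita connection is needed.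

*The cubic identity.* The fundamental form is `ω_{bc} = σ_{BC} ε_{B'C'}` with
`σ_{BC} = φ⁻¹ (α_B β_C + β_B α_C)`. As `σ_{BC} σ^{BC}` is constant, the Lee form is the divergence
`f_{AA'} = -½ σ^{BC} ∇_{BA'} σ_{CA}` (`lee_eq_divergence`), so that
`φ β^B f_{BA'} = -α^A β^B ∇_{AA'} β_B` and `φ α^B f_{BA'} = β^A α^B ∇_{AA'} α_B` (`lee_contract`).
Expanding the shear of `β + ε α` by the Leibniz rule, these are precisely the two relations that
turn the coefficients of `ε` and `ε²` into the connection terms of `C_{A'} ε` and `C̃_{A'} ε²`; the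
weights `w₀`, `w₁` cancel (`shear_deform`).

*Involutivity.* The projection of a field `X` to the `+1`-eigenbundle is `β^A p^{A'}` with
`p^{A'} = φ⁻¹ α_B X^{BA'}`. In the bracket of two such fields the derivatives of `p` and `q` only
contribute multiples of `β^A`, and the rest is skew in `p, q`, so that `P̃ [P X, P Y]` is
`p^{0'} q^{1'} - p^{1'} q^{0'}` times an invertible expression in the shear of `β`
(`coord_nijenhuisPlus`). Cutting off `β^A o^{0'}` and `β^A o^{1'}` by a bump function makes the
first factor `1` at a given point (`exists_section`), whence `involutive_iff_shearFree`.

*First order.* Neither `φ` nor `p^{A'}` changes when `β` is replaced by `β + ε_t α`, so the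
obstruction depends on `t` only through the shear. By the cubic identity and the symmetry of mixed
partial derivatives (`hasDerivAt_cderiv`), the `t`-derivative of the shear at `0` is `φ C_{A'} ε̇`
(`hasDerivAt_shear_deform`), which gives `involutiveToFirstOrder_iff`.
-/

noncomputable section

namespace ParaHermitian

section

variable {M : Type*} [TopologicalSpace M] [ChartedSpace (EuclideanSpace ℝ (Fin 4)) M]

/-! ### Calculus of complex vector fields -/

section Derivative

variable {f h : M → ℂ} {x : M}

lemma cderiv_eq (f : M → ℂ) (x : M) (v : CTangent x) :
    cderiv f x v = mvfderiv (𝓡 4) f x v.re + Complex.I * mvfderiv (𝓡 4) f x v.im := rfl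

lemma cderiv_add_vec (f : M → ℂ) (x : M) (v w : CTangent x) :
    cderiv f x (v + w) = cderiv f x v + cderiv f x w := by
  simp only [cderiv_eq, Cplx.add_re, Cplx.add_im, map_add]; ring

lemma cderiv_smul_vec (f : M → ℂ) (x : M) (z : ℂ) (v : CTangent x) :
    cderiv f x (z • v) = z * cderiv f x v := by
  simp only [cderiv_eq, Cplx.smul_re, Cplx.smul_im, map_add, map_sub, map_smul,
    Complex.real_smul]
  conv_rhs => rw [← Complex.re_add_im z]
  linear_combination (-(z.im : ℂ) * mvfderiv (𝓡 4) f x v.im) * Complex.I_sq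

/-- The derivative along complex tangent vectors as a `ℂ`-linear form. -/
def cderivLin (f : M → ℂ) (x : M) : CTangent x →ₗ[ℂ] ℂ where
  toFun := cderiv f x
  map_add' := cderiv_add_vec f x
  map_smul' := cderiv_smul_vec f x

lemma cderiv_sum_vec {κ : Type*} (s : Finset κ) (f : M → ℂ) (x : M) (z : κ → ℂ)
    (v : κ → CTangent x) :
    cderiv f x (∑ k ∈ s, z k • v k) = ∑ k ∈ s, z k * cderiv f x (v k) := by
  change cderivLin f x _ = ∑ k ∈ s, z k * cderivLin f x (v k)
  simp

lemma cderiv_congr (hfh : f =ᶠ[𝓝 x] h) (v : CTangent x) : cderiv f x v = cderiv h x v := by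
  simp only [cderiv, hfh.mfderiv_eq]

lemma cderiv_const (z : ℂ) (v : CTangent x) : cderiv (fun _ : M => z) x v = 0 := by
  simp [cderiv_eq, mvfderiv_const]

lemma cderiv_add (hf : MDifferentiableAt (𝓡 4) 𝓘(ℝ, ℂ) f x)
    (hh : MDifferentiableAt (𝓡 4) 𝓘(ℝ, ℂ) h x) (v : CTangent x) :
    cderiv (fun y => f y + h y) x v = cderiv f x v + cderiv h x v := by
  simp only [cderiv_eq]
  rw [show (fun y => f y + h y) = f + h from rfl, mvfderiv_add hf hh]
  simp only [add_apply]; ring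

lemma cderiv_neg (v : CTangent x) : cderiv (fun y => -f y) x v = -cderiv f x v := by
  simp only [cderiv_eq]
  rw [show (fun y => -f y) = -f from rfl, mvfderiv_neg]
  simp only [neg_apply]; ring

lemma mvfderiv_cmul (hf : MDifferentiableAt (𝓡 4) 𝓘(ℝ, ℂ) f x)
    (hh : MDifferentiableAt (𝓡 4) 𝓘(ℝ, ℂ) h x) (v : TangentSpace (𝓡 4) x) :
    mvfderiv (𝓡 4) (fun y => f y * h y) x v =
      f x * mvfderiv (𝓡 4) h x v + h x * mvfderiv (𝓡 4) f x v := by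
  have := (hf.hasMFDerivAt.mul hh.hasMFDerivAt).mfderiv
  change (mfderiv (𝓡 4) 𝓘(ℝ, ℂ) (f * h) x : _ →L[ℝ] ℂ) v = _
  rw [this]
  rfl

lemma cderiv_mul (hf : MDifferentiableAt (𝓡 4) 𝓘(ℝ, ℂ) f x)
    (hh : MDifferentiableAt (𝓡 4) 𝓘(ℝ, ℂ) h x) (v : CTangent x) :
    cderiv (fun y => f y * h y) x v = f x * cderiv h x v + h x * cderiv f x v := by
  simp only [cderiv_eq, mvfderiv_cmul hf hh]; ring

lemma mdifferentiableAt_cinv (hf : MDifferentiableAt (𝓡 4) 𝓘(ℝ, ℂ) f x) (h0 : f x ≠ 0) :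
    MDifferentiableAt (𝓡 4) 𝓘(ℝ, ℂ) (fun y => (f y)⁻¹) x := by
  have h1 : DifferentiableAt ℝ (fun z : ℂ => z⁻¹) (f x) :=
    (differentiableAt_inv (𝕜 := ℂ) h0).restrictScalars ℝ
  exact h1.mdifferentiableAt.comp x hf

lemma mvfderiv_re (hf : MDifferentiableAt (𝓡 4) 𝓘(ℝ, ℂ) f x) (v : TangentSpace (𝓡 4) x) :
    mvfderiv (𝓡 4) (fun y => (f y).re) x v = (mvfderiv (𝓡 4) f x v).re := by
  have h2 : MDifferentiableAt 𝓘(ℝ, ℂ) 𝓘(ℝ, ℝ) (Complex.reCLM) (f x) :=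
    Complex.reCLM.differentiableAt.mdifferentiableAt
  have h1 := mvfderiv_comp_apply (f := f) (g := Complex.reCLM) x h2 hf v
  rw [show (fun y => (f y).re) = Complex.reCLM ∘ f from rfl, h1]
  simp only [mvfderiv, mfderiv_eq_fderiv, ContinuousLinearMap.fderiv]
  rfl

lemma mdifferentiableAt_re (hf : MDifferentiableAt (𝓡 4) 𝓘(ℝ, ℂ) f x) :
    MDifferentiableAt (𝓡 4) 𝓘(ℝ, ℝ) (fun y => (f y).re) x :=
  Complex.reCLM.differentiableAt.mdifferentiableAt.comp x hf

lemma mdifferentiableAt_im (hf : MDifferentiableAt (𝓡 4) 𝓘(ℝ, ℂ) f x) :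
    MDifferentiableAt (𝓡 4) 𝓘(ℝ, ℝ) (fun y => (f y).im) x :=
  Complex.imCLM.differentiableAt.mdifferentiableAt.comp x hf

lemma mvfderiv_im (hf : MDifferentiableAt (𝓡 4) 𝓘(ℝ, ℂ) f x) (v : TangentSpace (𝓡 4) x) :
    mvfderiv (𝓡 4) (fun y => (f y).im) x v = (mvfderiv (𝓡 4) f x v).im := by
  have h2 : MDifferentiableAt 𝓘(ℝ, ℂ) 𝓘(ℝ, ℝ) (Complex.imCLM) (f x) :=
    Complex.imCLM.differentiableAt.mdifferentiableAt
  have h1 := mvfderiv_comp_apply (f := f) (g := Complex.imCLM) x h2 hf v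
  rw [show (fun y => (f y).im) = Complex.imCLM ∘ f from rfl, h1]
  simp only [mvfderiv, mfderiv_eq_fderiv, ContinuousLinearMap.fderiv]
  rfl

end Derivative

section Bracket

variable [IsManifold (𝓡 4) ∞ M] {x : M}

/-- A complex vector field is differentiable at `x` if its real and imaginary parts are. -/
def CDiffAt (X : ∀ x : M, CTangent x) (x : M) : Prop :=
  MDifferentiableAt (𝓡 4) (𝓡 4).tangent
    (fun x => (⟨x, (X x).re⟩ : TangentBundle (𝓡 4) M)) x ∧
  MDifferentiableAt (𝓡 4) (𝓡 4).tangent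
    (fun x => (⟨x, (X x).im⟩ : TangentBundle (𝓡 4) M)) x

lemma SmoothOn.cdiffAt {X : ∀ x : M, CTangent x} {U : Set M} (hX : SmoothOn X U)
    (hU : IsOpen U) (hx : x ∈ U) : CDiffAt X x :=
  ⟨(hX.1.contMDiffAt (hU.mem_nhds hx)).mdifferentiableAt (by simp),
    (hX.2.contMDiffAt (hU.mem_nhds hx)).mdifferentiableAt (by simp)⟩

lemma CDiffAt.add {X Y : ∀ x : M, CTangent x} (hX : CDiffAt X x) (hY : CDiffAt Y x) :
    CDiffAt (fun y => X y + Y y) x :=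
  ⟨mdifferentiableAt_add_section hX.1 hY.1, mdifferentiableAt_add_section hX.2 hY.2⟩

lemma CDiffAt.smul {f : M → ℂ} {X : ∀ x : M, CTangent x}
    (hf : MDifferentiableAt (𝓡 4) 𝓘(ℝ, ℂ) f x) (hX : CDiffAt X x) :
    CDiffAt (fun y => f y • X y) x :=
  ⟨mdifferentiableAt_sub_section ((mdifferentiableAt_re hf).smul_section hX.1)
      ((mdifferentiableAt_im hf).smul_section hX.2),
    mdifferentiableAt_add_section ((mdifferentiableAt_re hf).smul_section hX.2)
      ((mdifferentiableAt_im hf).smul_section hX.1)⟩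

lemma cdiffAt_zero : CDiffAt (fun y : M => (0 : CTangent y)) x := by
  have : MDifferentiableAt (𝓡 4) (𝓡 4).tangent
      (fun x => (⟨x, 0⟩ : TangentBundle (𝓡 4) M)) x :=
    (Bundle.contMDiff_zeroSection ℝ (TangentSpace (𝓡 4) : M → Type _)).contMDiffAt
      (n := 1) |>.mdifferentiableAt one_ne_zero
  exact ⟨this, this⟩

lemma CDiffAt.sum {κ : Type*} (s : Finset κ) {X : κ → ∀ x : M, CTangent x}
    (hX : ∀ k ∈ s, CDiffAt (X k) x) : CDiffAt (fun y => ∑ k ∈ s, X k y) x := by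
  classical
  induction s using Finset.induction_on with
  | empty => simpa using cdiffAt_zero
  | insert k s hk ih =>
    simp only [Finset.sum_insert hk]
    exact (hX k (by simp)).add (ih fun l hl => hX l (by simp [hl]))

omit [IsManifold (𝓡 4) ∞ M] in
lemma cbracket_swap (X Y : ∀ x : M, CTangent x) (x : M) :
    cbracket X Y x = -cbracket Y X x := by
  ext1
  · simp only [cbracket, Cplx.neg_re]
    rw [VectorField.mlieBracket_swap_apply (V := fun y => (X y).re),
      VectorField.mlieBracket_swap_apply (V := fun y => (X y).im)]
    abel
  · simp only [cbracket, Cplx.neg_im]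
    rw [VectorField.mlieBracket_swap_apply (V := fun y => (X y).re),
      VectorField.mlieBracket_swap_apply (V := fun y => (X y).im)]
    abel

omit [IsManifold (𝓡 4) ∞ M] in
lemma cbracket_congr {X X' Y Y' : ∀ x : M, CTangent x} (hX : ∀ᶠ y in 𝓝 x, X y = X' y)
    (hY : ∀ᶠ y in 𝓝 x, Y y = Y' y) : cbracket X Y x = cbracket X' Y' x := by
  have h1 : (fun y => (X y).re) =ᶠ[𝓝 x] fun y => (X' y).re := hX.mono fun y h => congrArg Cplx.re h
  have h2 : (fun y => (X y).im) =ᶠ[𝓝 x] fun y => (X' y).im := hX.mono fun y h => congrArg Cplx.im h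
  have h3 : (fun y => (Y y).re) =ᶠ[𝓝 x] fun y => (Y' y).re := hY.mono fun y h => congrArg Cplx.re h
  have h4 : (fun y => (Y y).im) =ᶠ[𝓝 x] fun y => (Y' y).im := hY.mono fun y h => congrArg Cplx.im h
  simp only [cbracket, h1.mlieBracket_vectorField_eq h3, h2.mlieBracket_vectorField_eq h4,
    h1.mlieBracket_vectorField_eq h4, h2.mlieBracket_vectorField_eq h3]

/-- The regularity under which Mathlib's bracket of vector fields obeys the Leibniz rule. -/
instance isManifold_two : IsManifold (𝓡 4) 2 M := IsManifold.of_le (n := ∞) (by norm_cast)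

lemma cbracket_add_right (X : ∀ x : M, CTangent x) {Y Z : ∀ x : M, CTangent x}
    (hY : CDiffAt Y x) (hZ : CDiffAt Z x) :
    cbracket X (fun y => Y y + Z y) x = cbracket X Y x + cbracket X Z x := by
  have key : ∀ V : ∀ y : M, TangentSpace (𝓡 4) y,
      VectorField.mlieBracket (𝓡 4) V (fun y => (Y y + Z y).re) x =
        VectorField.mlieBracket (𝓡 4) V (fun y => (Y y).re) x +
        VectorField.mlieBracket (𝓡 4) V (fun y => (Z y).re) x ∧
      VectorField.mlieBracket (𝓡 4) V (fun y => (Y y + Z y).im) x =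
        VectorField.mlieBracket (𝓡 4) V (fun y => (Y y).im) x +
        VectorField.mlieBracket (𝓡 4) V (fun y => (Z y).im) x := fun V =>
    ⟨VectorField.mlieBracket_add_right hY.1 hZ.1, VectorField.mlieBracket_add_right hY.2 hZ.2⟩
  ext1
  · simp only [cbracket, Cplx.add_re (V := TangentSpace (𝓡 4) x), (key _).1, (key _).2]; abel
  · simp only [cbracket, Cplx.add_im (V := TangentSpace (𝓡 4) x), (key _).1, (key _).2]; abel

/-- The Leibniz rule for the complex bracket. -/
lemma cbracket_smul_right (X : ∀ x : M, CTangent x) {f : M → ℂ} {Y : ∀ x : M, CTangent x}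
    (hf : MDifferentiableAt (𝓡 4) 𝓘(ℝ, ℂ) f x) (hY : CDiffAt Y x) :
    cbracket X (fun y => f y • Y y) x = f x • cbracket X Y x + cderiv f x (X x) • Y x := by
  have a := mdifferentiableAt_re hf
  have b := mdifferentiableAt_im hf
  have key : ∀ V : ∀ y : M, TangentSpace (𝓡 4) y,
      VectorField.mlieBracket (𝓡 4) V (fun y => (f y • Y y).re) x =
        ((mvfderiv (𝓡 4) f x (V x)).re • (Y x).re +
          (f x).re • VectorField.mlieBracket (𝓡 4) V (fun y => (Y y).re) x) -
        ((mvfderiv (𝓡 4) f x (V x)).im • (Y x).im +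
          (f x).im • VectorField.mlieBracket (𝓡 4) V (fun y => (Y y).im) x) ∧
      VectorField.mlieBracket (𝓡 4) V (fun y => (f y • Y y).im) x =
        ((mvfderiv (𝓡 4) f x (V x)).re • (Y x).im +
          (f x).re • VectorField.mlieBracket (𝓡 4) V (fun y => (Y y).im) x) +
        ((mvfderiv (𝓡 4) f x (V x)).im • (Y x).re +
          (f x).im • VectorField.mlieBracket (𝓡 4) V (fun y => (Y y).re) x) := by
    intro V
    have e1 := VectorField.mlieBracket_smul_right (V := V) a hY.1
    have e2 := VectorField.mlieBracket_smul_right (V := V) b hY.2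
    have e3 := VectorField.mlieBracket_smul_right (V := V) a hY.2
    have e4 := VectorField.mlieBracket_smul_right (V := V) b hY.1
    rw [mvfderiv_re hf] at e1 e3
    rw [mvfderiv_im hf] at e2 e4
    have hneg : MDifferentiableAt (𝓡 4) (𝓡 4).tangent
        (fun y => (⟨y, ((-1 : ℝ) • ((fun y => (f y).im) • fun y => (Y y).im)) y⟩ :
          TangentBundle (𝓡 4) M)) x :=
      MDifferentiableAt.smul_const_section (b.smul_section hY.2)
    constructor
    · rw [← e1, ← e2]
      have h1 := VectorField.mlieBracket_add_right (V := V) (a.smul_section hY.1) hneg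
      rw [VectorField.mlieBracket_const_smul_right (b.smul_section hY.2)] at h1
      convert h1 using 1
      · congr 1
        funext y
        simp [sub_eq_add_neg]
      · simp [sub_eq_add_neg]
    · rw [← e3, ← e4]
      exact VectorField.mlieBracket_add_right (a.smul_section hY.2) (b.smul_section hY.1)
  ext1
  · simp only [cbracket, Cplx.add_re (V := TangentSpace (𝓡 4) x),
      Cplx.smul_re (V := TangentSpace (𝓡 4) x), (key _).1, (key _).2, cderiv_eq,
      Complex.add_re, Complex.add_im, Complex.mul_re, Complex.mul_im, Complex.I_re, Complex.I_im]
    module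
  · simp only [cbracket, Cplx.add_im (V := TangentSpace (𝓡 4) x),
      Cplx.smul_im (V := TangentSpace (𝓡 4) x), (key _).1, (key _).2, cderiv_eq,
      Complex.add_re, Complex.add_im, Complex.mul_re, Complex.mul_im, Complex.I_re, Complex.I_im]
    module

omit [IsManifold (𝓡 4) ∞ M] in
lemma cbracket_zero_right (X : ∀ x : M, CTangent x) (x : M) :
    cbracket X (fun y => (0 : CTangent y)) x = 0 := by
  have h : VectorField.mlieBracket (𝓡 4) (fun y => (X y).re)
      (fun y => (0 : TangentSpace (𝓡 4) y)) x = 0 :=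
    congrFun (VectorField.mlieBracket_zero_right (I := 𝓡 4) (W := fun y => (X y).re)) x
  have h' : VectorField.mlieBracket (𝓡 4) (fun y => (X y).im)
      (fun y => (0 : TangentSpace (𝓡 4) y)) x = 0 :=
    congrFun (VectorField.mlieBracket_zero_right (I := 𝓡 4) (W := fun y => (X y).im)) x
  ext1
  · change _ - _ = (0 : TangentSpace (𝓡 4) x)
    exact (congrArg₂ _ h h').trans (sub_zero 0)
  · change _ + _ = (0 : TangentSpace (𝓡 4) x)
    exact (congrArg₂ _ h h').trans (add_zero 0)

lemma cbracket_sum_right {κ : Type*} (s : Finset κ) (X : ∀ x : M, CTangent x) {f : κ → M → ℂ}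
    {E : κ → ∀ x : M, CTangent x} (hf : ∀ k, MDifferentiableAt (𝓡 4) 𝓘(ℝ, ℂ) (f k) x)
    (hE : ∀ k, CDiffAt (E k) x) :
    cbracket X (fun y => ∑ k ∈ s, f k y • E k y) x =
      ∑ k ∈ s, (f k x • cbracket X (E k) x + cderiv (f k) x (X x) • E k x) := by
  classical
  induction s using Finset.induction_on with
  | empty => simpa using cbracket_zero_right X x
  | insert k s hk ih =>
    simp only [Finset.sum_insert hk]
    rw [cbracket_add_right X (.smul (hf k) (hE k)) (.sum s fun l _ => .smul (hf l) (hE l)), ih,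
      cbracket_smul_right X (hf k) (hE k)]

/-- The bracket of two linear combinations of the members of a frame. -/
lemma cbracket_sum_sum {κ : Type*} [Fintype κ] {f h : κ → M → ℂ}
    {E : κ → ∀ x : M, CTangent x} (hf : ∀ k, MDifferentiableAt (𝓡 4) 𝓘(ℝ, ℂ) (f k) x)
    (hh : ∀ k, MDifferentiableAt (𝓡 4) 𝓘(ℝ, ℂ) (h k) x) (hE : ∀ k, CDiffAt (E k) x) :
    cbracket (fun y => ∑ k, f k y • E k y) (fun y => ∑ k, h k y • E k y) x =
      ∑ k, ∑ l, (f k x * h l x) • cbracket (E k) (E l) x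
        + ∑ l, (∑ k, f k x * cderiv (h l) x (E k x)) • E l x
        - ∑ k, (∑ l, h l x * cderiv (f k) x (E l x)) • E k x := by
  rw [cbracket_sum_right _ _ hh hE]
  have h1 : ∀ l, cbracket (fun y => ∑ k, f k y • E k y) (E l) x =
      ∑ k, (f k x • cbracket (E k) (E l) x - cderiv (f k) x (E l x) • E k x) := by
    intro l
    rw [cbracket_swap, cbracket_sum_right _ _ hf hE, ← Finset.sum_neg_distrib]
    refine Finset.sum_congr rfl fun k _ => ?_
    rw [cbracket_swap (E l) (E k)]
    module
  simp only [h1, cderiv_sum_vec, Finset.sum_add_distrib, Finset.smul_sum, smul_sub,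
    Finset.sum_sub_distrib, smul_smul, Finset.sum_smul]
  rw [Finset.sum_comm (f := fun l k => (h l x * f k x) • cbracket (E k) (E l) x),
    Finset.sum_comm (f := fun l k => (h l x * cderiv (f k) x (E l x)) • E k x)]
  simp only [mul_comm (h _ x) (f _ x)]
  abel

end Bracket

end

section

variable {M : Type*} [TopologicalSpace M] [ChartedSpace (EuclideanSpace ℝ (Fin 4)) M]

/-! ### Null tetrads and the Levi-Civita connection -/

section Fibre

/-- The complexified tangent space has complex dimension four. -/
lemma finrank_cTangent (x : M) : Module.finrank ℂ (CTangent x) = 4 := by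
  let e : CTangent x ≃ₗ[ℂ] (Fin 4 → ℂ) :=
    { toFun := fun v k => ⟨(show EuclideanSpace ℝ (Fin 4) from v.re) k,
        (show EuclideanSpace ℝ (Fin 4) from v.im) k⟩
      invFun := fun z => ⟨(WithLp.toLp 2 fun k => (z k).re : EuclideanSpace ℝ (Fin 4)),
        (WithLp.toLp 2 fun k => (z k).im : EuclideanSpace ℝ (Fin 4))⟩
      left_inv := fun v => rfl
      right_inv := fun z => rfl
      map_add' := fun v w => rfl
      map_smul' := fun z v => by
        funext k
        apply Complex.ext
        · rfl
        · rfl }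
  rw [e.finrank_eq]
  simp

end Fibre

variable [IsManifold (𝓡 4) ∞ M]

section Metric

variable (g : PseudoMetric M) {x : M}

lemma PseudoMetric.c_add_left (u v w : CTangent x) :
    g.c x (u + v) w = g.c x u w + g.c x v w := by
  simp only [PseudoMetric.c, Cplx.add_re, Cplx.add_im, map_add, add_apply]
  push_cast; ring

lemma PseudoMetric.c_smul_left (z : ℂ) (v w : CTangent x) :
    g.c x (z • v) w = z * g.c x v w := by
  simp only [PseudoMetric.c, Cplx.smul_re, Cplx.smul_im, map_add, map_sub, map_smul, add_apply,
    sub_apply, smul_apply, smul_eq_mul]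
  conv_rhs => rw [← Complex.re_add_im z]
  push_cast
  linear_combination (-(z.im : ℂ) * (g.val x v.re w.im + g.val x v.im w.re)) * Complex.I_sq

/-- The form `g(·, w)` on complex tangent vectors. -/
def PseudoMetric.cLin (w : CTangent x) : CTangent x →ₗ[ℂ] ℂ where
  toFun v := g.c x v w
  map_add' u v := g.c_add_left u v w
  map_smul' z v := g.c_smul_left z v w

lemma PseudoMetric.c_neg_left (v w : CTangent x) : g.c x (-v) w = -g.c x v w :=
  map_neg (g.cLin w) v

lemma PseudoMetric.c_sum_left {κ : Type*} (s : Finset κ) (z : κ → ℂ) (v : κ → CTangent x)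
    (w : CTangent x) : g.c x (∑ k ∈ s, z k • v k) w = ∑ k ∈ s, z k * g.c x (v k) w := by
  change g.cLin w _ = ∑ k ∈ s, z k * g.cLin w (v k)
  simp

lemma PseudoMetric.mdifferentiableAt_c {X Y : ∀ x : M, CTangent x} (hX : CDiffAt X x)
    (hY : CDiffAt Y x) : MDifferentiableAt (𝓡 4) 𝓘(ℝ, ℂ) (fun y => g.c y (X y) (Y y)) x := by
  have key : ∀ V W : ∀ y : M, TangentSpace (𝓡 4) y,
      MDifferentiableAt (𝓡 4) (𝓡 4).tangent (fun y => (⟨y, V y⟩ : TangentBundle (𝓡 4) M)) x →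
      MDifferentiableAt (𝓡 4) (𝓡 4).tangent (fun y => (⟨y, W y⟩ : TangentBundle (𝓡 4) M)) x →
      MDifferentiableAt (𝓡 4) 𝓘(ℝ, ℂ) (fun y => ((g.val y (V y) (W y) : ℝ) : ℂ)) x := by
    intro V W hV hW
    have h : MDifferentiableAt (𝓡 4) ((𝓡 4).prod 𝓘(ℝ))
        (fun m ↦ Bundle.TotalSpace.mk' ℝ (E := Bundle.Trivial M ℝ) m (g.val m (V m) (W m))) x := by
      apply MDifferentiableAt.clm_bundle_apply₂ (F₁ := EuclideanSpace ℝ (Fin 4))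
        (F₂ := EuclideanSpace ℝ (Fin 4))
      · exact g.smooth.mdifferentiableAt (by simp)
      · exact hV
      · exact hW
    simp only [mdifferentiableAt_totalSpace] at h
    exact (Complex.ofRealCLM.differentiableAt.mdifferentiableAt).comp x h.2
  have hI : MDifferentiableAt (𝓡 4) 𝓘(ℝ, ℂ) (fun _ : M => Complex.I) x := mdifferentiableAt_const
  have h1 := ((key _ _ hX.1 hY.1).sub (key _ _ hX.2 hY.2)).add
    (hI.mul ((key _ _ hX.1 hY.2).add (key _ _ hX.2 hY.1)))
  refine h1.congr_of_eventuallyEq (Filter.Eventually.of_forall fun y => ?_)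
  simp only [PseudoMetric.c, Complex.ofReal_sub, Complex.ofReal_add]
  rfl

end Metric

lemma sum_eta_mul_eta (a c : Fin 2 × Fin 2) :
    ∑ b, eta a b * eta c b = if a = c then 1 else 0 := by
  obtain ⟨A, A'⟩ := a
  obtain ⟨B, B'⟩ := c
  fin_cases A <;> fin_cases A' <;> fin_cases B <;> fin_cases B' <;>
    simp [eta, eps, Fintype.sum_prod_type]

namespace SpinStructure

variable {g : PseudoMetric M} {ι : Type*} (S : SpinStructure g ι) {i : ι} {x : M}

lemma cdiffAt_e (hx : x ∈ S.U i) (a : Fin 2 × Fin 2) : CDiffAt (S.e i a) x :=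
  (S.smooth_e i a).cdiffAt (S.isOpen i) hx

/-- Coordinates in the tetrad as a linear form. -/
def coordLin (i : ι) (x : M) (a : Fin 2 × Fin 2) : CTangent x →ₗ[ℂ] ℂ :=
  ∑ b, eta a b • g.cLin (S.e i b x)

lemma coordLin_apply (a : Fin 2 × Fin 2) (v : CTangent x) :
    S.coordLin i x a v = S.coord i x v a := by
  simp [coordLin, coord, PseudoMetric.cLin]

lemma coord_e (hx : x ∈ S.U i) (a c : Fin 2 × Fin 2) :
    S.coord i x (S.e i c x) a = if a = c then 1 else 0 := by
  rw [coord, ← sum_eta_mul_eta a c]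
  exact Finset.sum_congr rfl fun b _ => by rw [S.metric_e i c b x hx]

lemma coord_sum_e (hx : x ∈ S.U i) (z : Fin 2 × Fin 2 → ℂ) (a : Fin 2 × Fin 2) :
    S.coord i x (∑ c, z c • S.e i c x) a = z a := by
  rw [← coordLin_apply, map_sum]
  simp [coordLin_apply, S.coord_e hx]

/-- The tetrad is a basis of the complexified tangent space. -/
lemma sum_coord_smul_e (hx : x ∈ S.U i) (v : CTangent x) :
    ∑ a, S.coord i x v a • S.e i a x = v := by
  have hli : LinearIndependent ℂ fun a => S.e i a x := by
    rw [Fintype.linearIndependent_iff]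
    intro z hz a
    rw [← S.coord_sum_e hx z a, hz, ← coordLin_apply, map_zero]
  have hspan : v ∈ Submodule.span ℂ (Set.range fun a => S.e i a x) := by
    have : FiniteDimensional ℂ (CTangent x) :=
      Module.finite_of_finrank_pos (by rw [finrank_cTangent]; norm_num)
    rw [hli.span_eq_top_of_card_eq_finrank' (by rw [finrank_cTangent]; simp)]
    trivial
  obtain ⟨z, rfl⟩ := (Submodule.mem_span_range_iff_exists_fun ℂ).1 hspan
  simp [S.coord_sum_e hx]

lemma eq_of_coord_eq (hx : x ∈ S.U i) {v w : CTangent x}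
    (h : ∀ a, S.coord i x v a = S.coord i x w a) : v = w := by
  rw [← S.sum_coord_smul_e hx v, ← S.sum_coord_smul_e hx w]
  simp [h]

lemma cderiv_metric_e (hx : x ∈ S.U i) (a b : Fin 2 × Fin 2) (v : CTangent x) :
    cderiv (fun y => g.c y (S.e i a y) (S.e i b y)) x v = 0 := by
  have h : (fun y => g.c y (S.e i a y) (S.e i b y)) =ᶠ[𝓝 x] fun _ => eta a b := by
    filter_upwards [(S.isOpen i).mem_nhds hx] with y hy using S.metric_e i a b y hy
  rw [cderiv_congr h, cderiv_const]

/-- The connection coefficients `g(∇_a e_b, e_c)` of the tetrad. -/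
def conn (i : ι) (x : M) (a b c : Fin 2 × Fin 2) : ℂ :=
  g.leviCivita (S.e i a) (S.e i b) (S.e i c) x

/-- The Levi-Civita connection is metric. -/
lemma conn_antisymm (hx : x ∈ S.U i) (a b c : Fin 2 × Fin 2) :
    S.conn i x a b c = -S.conn i x a c b := by
  simp only [conn, PseudoMetric.leviCivita, S.cderiv_metric_e hx]
  rw [cbracket_swap (S.e i c) (S.e i a), cbracket_swap (S.e i c) (S.e i b),
    cbracket_swap (S.e i b) (S.e i a)]
  simp only [g.c_neg_left]
  ring

/-- The Levi-Civita connection is torsion-free. -/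
lemma c_cbracket_e (hx : x ∈ S.U i) (a b c : Fin 2 × Fin 2) :
    g.c x (cbracket (S.e i a) (S.e i b) x) (S.e i c x) =
      S.conn i x a b c - S.conn i x b a c := by
  simp only [conn, PseudoMetric.leviCivita, S.cderiv_metric_e hx]
  rw [cbracket_swap (S.e i c) (S.e i a), cbracket_swap (S.e i c) (S.e i b),
    cbracket_swap (S.e i b) (S.e i a)]
  simp only [g.c_neg_left]
  ring

lemma coord_cbracket_e (hx : x ∈ S.U i) (a b d : Fin 2 × Fin 2) :
    S.coord i x (cbracket (S.e i a) (S.e i b) x) d =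
      ∑ c, eta d c * (S.conn i x a b c - S.conn i x b a c) := by
  simp only [coord, S.c_cbracket_e hx]

lemma mdifferentiableAt_coord (hx : x ∈ S.U i) {X : ∀ x : M, CTangent x} (hX : CDiffAt X x)
    (a : Fin 2 × Fin 2) :
    MDifferentiableAt (𝓡 4) 𝓘(ℝ, ℂ) (fun y => S.coord i y (X y) a) x := by
  have h : ∀ b, MDifferentiableAt (𝓡 4) 𝓘(ℝ, ℂ)
      (fun y => eta a b * g.c y (X y) (S.e i b y)) x := fun b =>
    MDifferentiableAt.mul mdifferentiableAt_const (g.mdifferentiableAt_c hX (S.cdiffAt_e hx b))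
  simp only [coord, Fintype.sum_prod_type, Fin.sum_univ_two]
  exact ((h _).add (h _)).add ((h _).add (h _))

/-! ### Spinor fields -/

variable {α β : ι → M → Fin 2 → ℂ}

lemma IsSpinorField.mdifferentiableAt (hα : S.IsSpinorField α) (hx : x ∈ S.U i) (A : Fin 2) :
    MDifferentiableAt (𝓡 4) 𝓘(ℝ, ℂ) (fun y => α i y A) x :=
  ((hα.smooth i A).contMDiffAt ((S.isOpen i).mem_nhds hx)).mdifferentiableAt (by simp)

lemma IsSpinorField.deform (hα : S.IsSpinorField α) (hβ : S.IsSpinorField β) {ε : M → ℂ}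
    (hε : SmoothFun ε) : S.IsSpinorField (deform α β ε) where
  smooth j A := (hβ.smooth j A).add
    ((contDiff_fst.mul contDiff_snd : ContDiff ℝ ∞ fun p : ℂ × ℂ => p.1 * p.2).contMDiff
      |>.comp_contMDiffOn ((ContMDiff.contMDiffOn hε).prodMk_space (hα.smooth j A)))
  trans j k y hj hk A := by
    simp only [ParaHermitian.deform, hα.trans j k y hj hk A, hβ.trans j k y hj hk A,
      Fin.sum_univ_two]
    ring

lemma coord_of_represents {K : ∀ x : M, CTangent x →ₗ[ℂ] CTangent x} (hK : S.Represents K α β)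
    (hx : x ∈ S.U i) (v : CTangent x) (a : Fin 2 × Fin 2) :
    S.coord i x (K x v) a = (contract (α i x) (β i x))⁻¹ *
      ∑ B, (α i x a.1 * lower (β i x) B + β i x a.1 * lower (α i x) B) *
        S.coord i x v (B, a.2) := by
  rw [hK i x hx v, S.coord_sum_e hx]

end SpinStructure

omit [TopologicalSpace M] [ChartedSpace (EuclideanSpace ℝ (Fin 4)) M] [IsManifold (𝓡 4) ∞ M] in
lemma contract_deform {ι : Type*} (α β : ι → M → Fin 2 → ℂ) (ε : M → ℂ) (i : ι) (x : M) :
    contract (α i x) (deform α β ε i x) = contract (α i x) (β i x) := by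
  simp [contract, deform, Fin.sum_univ_two, eps]
  ring

end

section

/-! ### The Lee form -/

section Algebra

/-- The spin connection coefficients `γ_{aB}{}^D` of connection coefficients `G_{abc}`, given as
plain functions. For `G = S.conn i x` this is `S.spinCoeff`, by definition. -/
def spinGamma (G : Fin 2 × Fin 2 → Fin 2 × Fin 2 → Fin 2 × Fin 2 → ℂ) (a : Fin 2 × Fin 2)
    (B D : Fin 2) : ℂ :=
  (1 / 2 : ℂ) * ∑ C : Fin 2, ∑ B' : Fin 2, ∑ C' : Fin 2,
    eps D C * eps B' C' * G a (B, B') (C, C')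

lemma spinGamma_trace {G : Fin 2 × Fin 2 → Fin 2 × Fin 2 → Fin 2 × Fin 2 → ℂ}
    (hG : ∀ a b c, G a b c = -G a c b) (a : Fin 2 × Fin 2) :
    spinGamma G a 1 1 = -spinGamma G a 0 0 := by
  simp only [spinGamma, eps, Fin.sum_univ_two]
  simp
  rw [hG a (1, 0) (0, 1), hG a (1, 1) (0, 0)]
  ring

/-- The exterior derivative of `σ_{BC} ε_{B'C'}` in a tetrad, with `dσ` the derivatives of `σ`
and `G` the connection coefficients. -/
def extDerivSpin (σ : Fin 2 → Fin 2 → ℂ) (dσ : Fin 2 × Fin 2 → Fin 2 → Fin 2 → ℂ)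
    (G : Fin 2 × Fin 2 → Fin 2 × Fin 2 → Fin 2 × Fin 2 → ℂ) (a b c : Fin 2 × Fin 2) : ℂ :=
  dσ a b.1 c.1 * eps b.2 c.2 + dσ b c.1 a.1 * eps c.2 a.2 + dσ c a.1 b.1 * eps a.2 b.2
    - (∑ d, (∑ h, eta d h * (G a b h - G b a h)) * (σ d.1 c.1 * eps d.2 c.2))
    - (∑ d, (∑ h, eta d h * (G b c h - G c b h)) * (σ d.1 a.1 * eps d.2 a.2))
    - (∑ d, (∑ h, eta d h * (G c a h - G a c h)) * (σ d.1 b.1 * eps d.2 b.2))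

/-- The raised components `σ^{BC} ε^{B'C'}` of a symmetric `σ`. -/
lemma sum_eta_eta_mul {σ : Fin 2 → Fin 2 → ℂ} (hσ : σ 1 0 = σ 0 1) (b c : Fin 2 × Fin 2) :
    (∑ d, ∑ h, eta b d * eta c h * (σ d.1 h.1 * eps d.2 h.2)) =
      (∑ D, ∑ H, eps b.1 D * eps c.1 H * σ D H) * eps b.2 c.2 := by
  obtain ⟨B, B'⟩ := b
  obtain ⟨C, C'⟩ := c
  fin_cases B <;> fin_cases B' <;> fin_cases C <;> fin_cases C' <;>
    simp [eta, eps, Fintype.sum_prod_type, hσ]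

set_option maxHeartbeats 2000000 in
/-- The Lee form as a spinor divergence, `f_{AA'} = -½ σ^{BC} ∇_{BA'} σ_{CA}`. The derivative
of `σ_{BC} σ^{BC}` along `a` drops out, as this function is constant. -/
lemma lee_eq_divergence {σ : Fin 2 → Fin 2 → ℂ} {dσ : Fin 2 × Fin 2 → Fin 2 → Fin 2 → ℂ}
    {G : Fin 2 × Fin 2 → Fin 2 × Fin 2 → Fin 2 × Fin 2 → ℂ}
    (hσ : σ 1 0 = σ 0 1) (hdσ : ∀ a, dσ a 1 0 = dσ a 0 1)
    (hnorm : ∀ a, dσ a 0 0 * σ 1 1 + σ 0 0 * dσ a 1 1 - 2 * σ 0 1 * dσ a 0 1 = 0)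
    (hG : ∀ a b c, G a b c = -G a c b) (A A' : Fin 2) :
    (1 / 4 : ℂ) * ∑ b : Fin 2 × Fin 2, ∑ c : Fin 2 × Fin 2,
      (∑ d, ∑ h, eta b d * eta c h * (σ d.1 h.1 * eps d.2 h.2)) *
        extDerivSpin σ dσ G (A, A') b c =
      -(1 / 2 : ℂ) * ∑ B, ∑ C, (∑ D, ∑ H, eps B D * eps C H * σ D H) *
        (dσ (B, A') C A - (∑ D, spinGamma G (B, A') C D * σ D A)
          - ∑ D, spinGamma G (B, A') A D * σ C D) := by
  have hdiag : ∀ a b, G a b b = 0 := fun a b => by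
    have := hG a b b
    linear_combination (1 / 2 : ℂ) * this
  have h1 : ∀ a, G a (0, 1) (0, 0) = -G a (0, 0) (0, 1) := fun a => hG _ _ _
  have h2 : ∀ a, G a (1, 0) (0, 0) = -G a (0, 0) (1, 0) := fun a => hG _ _ _
  have h3 : ∀ a, G a (1, 1) (0, 0) = -G a (0, 0) (1, 1) := fun a => hG _ _ _
  have h4 : ∀ a, G a (1, 0) (0, 1) = -G a (0, 1) (1, 0) := fun a => hG _ _ _
  have h5 : ∀ a, G a (1, 1) (0, 1) = -G a (0, 1) (1, 1) := fun a => hG _ _ _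
  have h6 : ∀ a, G a (1, 1) (1, 0) = -G a (1, 0) (1, 1) := fun a => hG _ _ _
  simp only [sum_eta_eta_mul hσ]
  have hn := hnorm (A, A')
  fin_cases A <;> fin_cases A' <;>
  · simp [extDerivSpin, spinGamma, eta, eps, Fintype.sum_prod_type, hσ, hdσ, hdiag, h1, h2, h3, h4,
      h5, h6] at hn ⊢
    linear_combination (1 / 2 : ℂ) * hn

/-- The symmetric spinor `σ_{BC} = φ⁻¹ (α_B β_C + β_B α_C)` of the fundamental form
`ω_{bc} = σ_{BC} ε_{B'C'}`. -/
def fundSpinor (α β : Fin 2 → ℂ) (B C : Fin 2) : ℂ :=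
  (contract α β)⁻¹ * (lower α B * lower β C + lower β B * lower α C)

/-- The derivative of `fundSpinor` in terms of the derivatives of the two spinors. -/
def derivFundSpinor (α β dα dβ : Fin 2 → ℂ) (B C : Fin 2) : ℂ :=
  (contract α β)⁻¹ * (lower dα B * lower β C + lower α B * lower dβ C
    + (lower dβ B * lower α C + lower β B * lower dα C)
    - (contract dα β + contract α dβ) * fundSpinor α β B C)

lemma fundSpinor_symm (α β : Fin 2 → ℂ) : fundSpinor α β 1 0 = fundSpinor α β 0 1 := by
  simp only [fundSpinor]; ring

lemma derivFundSpinor_symm (α β dα dβ : Fin 2 → ℂ) :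
    derivFundSpinor α β dα dβ 1 0 = derivFundSpinor α β dα dβ 0 1 := by
  simp only [derivFundSpinor, fundSpinor_symm]; ring

lemma contract_eq (α β : Fin 2 → ℂ) : contract α β = α 0 * β 1 - α 1 * β 0 := by
  simp [contract, eps, Fin.sum_univ_two]; ring

lemma lower_zero (φ : Fin 2 → ℂ) : lower φ 0 = -φ 1 := by simp [lower, eps]

lemma lower_one (φ : Fin 2 → ℂ) : lower φ 1 = φ 0 := by simp [lower, eps]

/-- The derivative of `σ_{BC} σ^{BC}`, a constant function, is zero. -/
lemma derivFundSpinor_norm {α β : Fin 2 → ℂ} (dα dβ : Fin 2 → ℂ) (hφ : contract α β ≠ 0) :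
    derivFundSpinor α β dα dβ 0 0 * fundSpinor α β 1 1
      + fundSpinor α β 0 0 * derivFundSpinor α β dα dβ 1 1
      - 2 * fundSpinor α β 0 1 * derivFundSpinor α β dα dβ 0 1 = 0 := by
  simp only [derivFundSpinor, fundSpinor, contract_eq, lower_zero, lower_one] at hφ ⊢
  field_simp
  ring

/-- The divergence of `σ`, contracted with `β` and with `α`. -/
lemma divergence_contract {α β : Fin 2 → ℂ} {dα dβ : Fin 2 × Fin 2 → Fin 2 → ℂ}
    {γ : Fin 2 × Fin 2 → Fin 2 → Fin 2 → ℂ} (hφ : contract α β ≠ 0)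
    (hγ : ∀ a, γ a 1 1 = -γ a 0 0) (A' : Fin 2) {F : Fin 2 → ℂ}
    (hF : ∀ A, F A = -(1 / 2 : ℂ) * ∑ B, ∑ C,
      (∑ D, ∑ H, eps B D * eps C H * fundSpinor α β D H) *
        (derivFundSpinor α β (dα (B, A')) (dβ (B, A')) C A
          - (∑ D, γ (B, A') C D * fundSpinor α β D A)
          - ∑ D, γ (B, A') A D * fundSpinor α β C D)) :
    contract α β * ∑ B, F B * β B = -∑ A, ∑ B, ∑ C, α A * β B * eps C B *
        (dβ (A, A') C + ∑ D, γ (A, A') D C * β D) ∧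
    contract α β * ∑ B, F B * α B = ∑ A, ∑ B, ∑ C, β A * α B * eps C B *
        (dα (A, A') C + ∑ D, γ (A, A') D C * α D) := by
  simp only [Fin.sum_univ_two, hF, derivFundSpinor, fundSpinor, contract_eq, lower_zero, lower_one,
    hγ] at hφ ⊢
  simp [eps] at hφ ⊢
  constructor
  · field_simp
    ring
  · field_simp
    ring

end Algebra

variable {M : Type*} [TopologicalSpace M] [ChartedSpace (EuclideanSpace ℝ (Fin 4)) M]
  [IsManifold (𝓡 4) ∞ M]

namespace SpinStructure

variable {g : PseudoMetric M} {ι : Type*} (S : SpinStructure g ι) {i : ι} {x : M}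
  {α β : ι → M → Fin 2 → ℂ} {K : ∀ x : M, CTangent x →ₗ[ℂ] CTangent x}

lemma c_e_eq (hx : x ∈ S.U i) (v : CTangent x) (c : Fin 2 × Fin 2) :
    g.c x v (S.e i c x) = ∑ a, S.coord i x v a * eta a c := by
  conv_lhs => rw [← S.sum_coord_smul_e hx v, g.c_sum_left]
  exact Finset.sum_congr rfl fun a _ => by rw [S.metric_e i a c x hx]

lemma fundForm_e (hK : S.Represents K α β) (hx : x ∈ S.U i) (v : CTangent x)
    (c : Fin 2 × Fin 2) :
    fundForm g K x v (S.e i c x) =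
      ∑ b, S.coord i x v b * (fundSpinor (α i x) (β i x) b.1 c.1 * eps b.2 c.2) := by
  obtain ⟨C, C'⟩ := c
  rw [fundForm, S.c_e_eq hx]
  simp only [S.coord_of_represents hK hx, fundSpinor]
  fin_cases C <;> fin_cases C' <;>
    simp [eta, eps, lower_zero, lower_one, Fintype.sum_prod_type] <;> ring

lemma fundForm_e_e (hK : S.Represents K α β) (hx : x ∈ S.U i) (b c : Fin 2 × Fin 2) :
    fundForm g K x (S.e i b x) (S.e i c x) =
      fundSpinor (α i x) (β i x) b.1 c.1 * eps b.2 c.2 := by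
  rw [S.fundForm_e hK hx]
  simp [S.coord_e hx]

lemma mdifferentiableAt_and_cderiv_fundSpinor (hα : S.IsSpinorField α) (hβ : S.IsSpinorField β) (hx : x ∈ S.U i)
    (hφ : contract (α i x) (β i x) ≠ 0) (v : CTangent x) (B C : Fin 2) :
    MDifferentiableAt (𝓡 4) 𝓘(ℝ, ℂ) (fun y => fundSpinor (α i y) (β i y) B C) x ∧
    cderiv (fun y => fundSpinor (α i y) (β i y) B C) x v =
      derivFundSpinor (α i x) (β i x) (fun A => cderiv (fun y => α i y A) x v)
        (fun A => cderiv (fun y => β i y A) x v) B C := by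
  have dα := hα.mdifferentiableAt S hx
  have dβ := hβ.mdifferentiableAt S hx
  have dneg : ∀ {f : M → ℂ}, MDifferentiableAt (𝓡 4) 𝓘(ℝ, ℂ) f x →
      MDifferentiableAt (𝓡 4) 𝓘(ℝ, ℂ) (fun y => -f y) x := fun h => h.neg
  have dlow : ∀ {φ : ι → M → Fin 2 → ℂ}, S.IsSpinorField φ → ∀ A,
      MDifferentiableAt (𝓡 4) 𝓘(ℝ, ℂ) (fun y => lower (φ i y) A) x ∧
      cderiv (fun y => lower (φ i y) A) x v =
        lower (fun A => cderiv (fun y => φ i y A) x v) A := by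
    intro φ hφ A
    have dφ := hφ.mdifferentiableAt S hx
    fin_cases A
    · simp only [Fin.zero_eta, lower_zero, cderiv_neg]
      exact ⟨dneg (dφ 1), trivial⟩
    · simp only [Fin.mk_one, lower_one]
      exact ⟨dφ 0, trivial⟩
  have dmul : ∀ {f h : M → ℂ}, MDifferentiableAt (𝓡 4) 𝓘(ℝ, ℂ) f x →
      MDifferentiableAt (𝓡 4) 𝓘(ℝ, ℂ) h x →
      MDifferentiableAt (𝓡 4) 𝓘(ℝ, ℂ) (fun y => f y * h y) x := fun h h' => h.mul h'
  have dadd : ∀ {f h : M → ℂ}, MDifferentiableAt (𝓡 4) 𝓘(ℝ, ℂ) f x →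
      MDifferentiableAt (𝓡 4) 𝓘(ℝ, ℂ) h x →
      MDifferentiableAt (𝓡 4) 𝓘(ℝ, ℂ) (fun y => f y + h y) x := fun h h' => h.add h'
  have hcon : (fun y => contract (α i y) (β i y)) =
      fun y => α i y 0 * β i y 1 + -(α i y 1 * β i y 0) := by
    funext y; rw [contract_eq]; ring
  have dcon : MDifferentiableAt (𝓡 4) 𝓘(ℝ, ℂ) (fun y => contract (α i y) (β i y)) x := by
    rw [hcon]
    exact dadd (dmul (dα 0) (dβ 1)) (dneg (dmul (dα 1) (dβ 0)))
  have ccon : cderiv (fun y => contract (α i y) (β i y)) x v =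
      contract (fun A => cderiv (fun y => α i y A) x v) (β i x)
        + contract (α i x) (fun A => cderiv (fun y => β i y A) x v) := by
    rw [hcon, cderiv_add (dmul (dα 0) (dβ 1)) (dneg (dmul (dα 1) (dβ 0))), cderiv_neg,
      cderiv_mul (dα 0) (dβ 1), cderiv_mul (dα 1) (dβ 0), contract_eq, contract_eq]
    ring
  have dnum := dadd (dmul (dlow hα B).1 (dlow hβ C).1) (dmul (dlow hβ B).1 (dlow hα C).1)
  have dσ : MDifferentiableAt (𝓡 4) 𝓘(ℝ, ℂ)
      (fun y => fundSpinor (α i y) (β i y) B C) x := dmul (mdifferentiableAt_cinv dcon hφ) dnum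
  refine ⟨dσ, ?_⟩
  -- differentiate `φ σ = α_B β_C + β_B α_C`, which holds where `φ ≠ 0`
  have hprod : (fun y => contract (α i y) (β i y) * fundSpinor (α i y) (β i y) B C) =ᶠ[𝓝 x]
      fun y => lower (α i y) B * lower (β i y) C + lower (β i y) B * lower (α i y) C := by
    filter_upwards [dcon.continuousAt.eventually_ne hφ] with y hy
    rw [fundSpinor, mul_inv_cancel_left₀ hy]
  have := cderiv_congr hprod v
  rw [cderiv_mul dcon dσ, ccon,
    cderiv_add (dmul (dlow hα B).1 (dlow hβ C).1) (dmul (dlow hβ B).1 (dlow hα C).1),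
    cderiv_mul (dlow hα B).1 (dlow hβ C).1, cderiv_mul (dlow hβ B).1 (dlow hα C).1,
    (dlow hα B).2, (dlow hβ B).2, (dlow hα C).2, (dlow hβ C).2] at this
  rw [derivFundSpinor, eq_inv_mul_iff_mul_eq₀ hφ]
  linear_combination this

lemma extDerivTwo_fundForm (hK : S.Represents K α β) (hα : S.IsSpinorField α)
    (hβ : S.IsSpinorField β) (hx : x ∈ S.U i) (hφ : contract (α i x) (β i x) ≠ 0)
    (a b c : Fin 2 × Fin 2) :
    extDerivTwo (fundForm g K) (S.e i a) (S.e i b) (S.e i c) x =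
      extDerivSpin (fundSpinor (α i x) (β i x))
        (fun d => derivFundSpinor (α i x) (β i x)
          (fun A => cderiv (fun y => α i y A) x (S.e i d x))
          (fun A => cderiv (fun y => β i y A) x (S.e i d x))) (S.conn i x) a b c := by
  have h : ∀ b c : Fin 2 × Fin 2, ∀ v : CTangent x,
      cderiv (fun y => fundForm g K y (S.e i b y) (S.e i c y)) x v =
        derivFundSpinor (α i x) (β i x) (fun A => cderiv (fun y => α i y A) x v)
          (fun A => cderiv (fun y => β i y A) x v) b.1 c.1 * eps b.2 c.2 := by
    intro b c v
    have h1 : (fun y => fundForm g K y (S.e i b y) (S.e i c y)) =ᶠ[𝓝 x]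
        fun y => eps b.2 c.2 * fundSpinor (α i y) (β i y) b.1 c.1 := by
      filter_upwards [(S.isOpen i).mem_nhds hx] with y hy
      rw [S.fundForm_e_e hK hy, mul_comm]
    obtain ⟨dσ, hσ⟩ := S.mdifferentiableAt_and_cderiv_fundSpinor hα hβ hx hφ v b.1 c.1
    rw [cderiv_congr h1, cderiv_mul mdifferentiableAt_const dσ, cderiv_const, hσ]
    ring
  simp only [extDerivTwo, h, S.fundForm_e hK hx, S.coord_cbracket_e hx, extDerivSpin]

/-- The Lee form contracted with `β` and with `α`: `φ β^B f_{BA'} = -α^A β^B ∇_{AA'} β_B` and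
`φ α^B f_{BA'} = β^A α^B ∇_{AA'} α_B`. -/
lemma lee_contract (hK : S.Represents K α β) (hα : S.IsSpinorField α)
    (hβ : S.IsSpinorField β) (hx : x ∈ S.U i) (hφ : contract (α i x) (β i x) ≠ 0)
    (A' : Fin 2) :
    contract (α i x) (β i x) * ∑ B, S.lee K i (B, A') x * β i x B =
      -∑ A, ∑ B, ∑ C, α i x A * β i x B * eps C B * S.nabla i (β i) (A, A') C x ∧
    contract (α i x) (β i x) * ∑ B, S.lee K i (B, A') x * α i x B =
      ∑ A, ∑ B, ∑ C, β i x A * α i x B * eps C B * S.nabla i (α i) (A, A') C x := by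
  refine divergence_contract (γ := spinGamma (S.conn i x))
    (dα := fun a A => cderiv (fun y => α i y A) x (S.e i a x))
    (dβ := fun a A => cderiv (fun y => β i y A) x (S.e i a x)) hφ
    (spinGamma_trace (S.conn_antisymm hx)) A' (F := fun B => S.lee K i (B, A') x) fun A => ?_
  refine Eq.trans ?_ (lee_eq_divergence (dσ := fun d => derivFundSpinor (α i x) (β i x)
      (fun A => cderiv (fun y => α i y A) x (S.e i d x))
      (fun A => cderiv (fun y => β i y A) x (S.e i d x)))
    (fundSpinor_symm _ _) (fun a => derivFundSpinor_symm _ _ _ _)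
    (fun a => derivFundSpinor_norm _ _ hφ) (S.conn_antisymm hx) A A')
  simp only [lee, S.fundForm_e_e hK hx, S.extDerivTwo_fundForm hK hα hβ hx hφ]

/-! ### The shear of a deformed spinor -/

/-- The covariant derivative of `β + ε α`. -/
lemma nabla_deform (hα : S.IsSpinorField α) (hβ : S.IsSpinorField β) (hx : x ∈ S.U i)
    {ε : M → ℂ} (hε : SmoothFun ε) (a : Fin 2 × Fin 2) (C : Fin 2) :
    S.nabla i (deform α β ε i) a C x = S.nabla i (β i) a C x + ε x * S.nabla i (α i) a C x
      + cderiv ε x (S.e i a x) * α i x C := by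
  have dα := hα.mdifferentiableAt S hx C
  have dβ := hβ.mdifferentiableAt S hx C
  have dε : MDifferentiableAt (𝓡 4) 𝓘(ℝ, ℂ) ε x := (ContMDiff.contMDiffAt hε).mdifferentiableAt
    (by simp)
  have dεα : MDifferentiableAt (𝓡 4) 𝓘(ℝ, ℂ) (fun y => ε y * α i y C) x := dε.mul dα
  simp only [nabla, deform, Fin.sum_univ_two]
  rw [cderiv_add dβ dεα, cderiv_mul dε dα]
  ring

/-- The shear of `β + ε α` is a cubic polynomial in `ε` and its first derivatives. -/
theorem shear_deform (hK : S.Represents K α β) (hα : S.IsSpinorField α)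
    (hβ : S.IsSpinorField β) (hx : x ∈ S.U i) (hφ : contract (α i x) (β i x) ≠ 0)
    (w₀ w₁ : ℝ) {ε : M → ℂ} (hε : SmoothFun ε) (A' : Fin 2) :
    S.shear i (deform α β ε i) A' x =
      S.shear i (β i) A' x
        + contract (α i x) (β i x) *
            S.weightedDerivβ K α β w₀ w₁ (-1) 1 (w₁ - w₀) i ε A' x
        + (1 / 2 : ℂ) * contract (α i x) (β i x) *
            S.weightedDerivα K α β w₀ w₁ (-2) 2 (2 * (w₁ - w₀)) i (fun y => ε y ^ 2) A' x
        + S.shear i (α i) A' x * ε x ^ 3 := by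
  have dε : MDifferentiableAt (𝓡 4) 𝓘(ℝ, ℂ) ε x := (ContMDiff.contMDiffAt hε).mdifferentiableAt
    (by simp)
  obtain ⟨h1, h2⟩ := S.lee_contract hK hα hβ hx hφ A'
  have hsq : ∀ v : CTangent x, cderiv (fun y => ε y ^ 2) x v = 2 * ε x * cderiv ε x v := by
    intro v
    simp only [pow_two]
    rw [cderiv_mul dε dε]; ring
  have hp := contract_eq (α i x) (β i x)
  simp only [shear, S.nabla_deform hα hβ hx hε, weightedDerivβ, weightedDerivα, weightedDeriv, hsq,
    connL, connM, deform, lower_zero, lower_one, Fin.sum_univ_two] at h1 h2 ⊢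
  generalize contract (α i x) (β i x) = p at hφ h1 h2 hp ⊢
  simp [eps] at h1 h2 ⊢
  field_simp
  subst hp
  linear_combination ε x * h1 - ε x ^ 2 * h2

end SpinStructure

end

section

/-! ### The obstruction to involutivity -/

section Algebra

set_option maxHeartbeats 1000000 in
/-- The `α`-part of the bracket of two sections `β^A p^{A'}`, `β^A q^{A'}` of the `+1`-eigenbundle
is a multiple of the shear, with a factor bilinear and skew in `p` and `q`. The derivatives of `p`
and `q` are absent, see `lower_mul_derivative`. -/
lemma lower_mul_bracket {β p q : Fin 2 → ℂ} {dβ : Fin 2 × Fin 2 → Fin 2 → ℂ}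
    {G : Fin 2 × Fin 2 → Fin 2 × Fin 2 → Fin 2 × Fin 2 → ℂ}
    (hG : ∀ a b c, G a b c = -G a c b) (A' : Fin 2) :
    (∑ B, lower β B * ((∑ k : Fin 2 × Fin 2, ∑ l : Fin 2 × Fin 2,
        β k.1 * p k.2 * (β l.1 * q l.2) * ∑ c, eta (B, A') c * (G k l c - G l k c))
      + (∑ k : Fin 2 × Fin 2, β k.1 * p k.2 * (q A' * dβ k B))
      - ∑ l : Fin 2 × Fin 2, β l.1 * q l.2 * (p A' * dβ l B))) =
    (p 0 * q 1 - p 1 * q 0) * ∑ B', eps A' B' * ∑ A, ∑ B, ∑ C,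
      β A * β B * eps C B * (dβ (A, B') C + ∑ D, spinGamma G (A, B') D C * β D) := by
  have hdiag : ∀ a b, G a b b = 0 := fun a b => by
    have := hG a b b
    linear_combination (1 / 2 : ℂ) * this
  have h1 : ∀ a, G a (0, 1) (0, 0) = -G a (0, 0) (0, 1) := fun a => hG _ _ _
  have h2 : ∀ a, G a (1, 0) (0, 0) = -G a (0, 0) (1, 0) := fun a => hG _ _ _
  have h3 : ∀ a, G a (1, 1) (0, 0) = -G a (0, 0) (1, 1) := fun a => hG _ _ _
  have h4 : ∀ a, G a (1, 0) (0, 1) = -G a (0, 1) (1, 0) := fun a => hG _ _ _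
  have h5 : ∀ a, G a (1, 1) (0, 1) = -G a (0, 1) (1, 1) := fun a => hG _ _ _
  have h6 : ∀ a, G a (1, 1) (1, 0) = -G a (1, 0) (1, 1) := fun a => hG _ _ _
  fin_cases A' <;>
  · simp [spinGamma, eta, eps, lower_zero, lower_one, Fintype.sum_prod_type, hdiag, h1, h2, h3, h4,
      h5, h6]
    ring

/-- Since `β_B β^B = 0`, derivatives of the coefficients of `β^B` do not contribute. -/
lemma lower_mul_derivative (β T : Fin 2 → ℂ) (p q : ℂ) (f h Dp Dq : Fin 2 × Fin 2 → ℂ)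
    (dβ : Fin 2 × Fin 2 → Fin 2 → ℂ) :
    (∑ B, lower β B * (T B + (∑ k, f k * (β B * Dq k + q * dβ k B))
      - ∑ l, h l * (β B * Dp l + p * dβ l B))) =
    ∑ B, lower β B * (T B + (∑ k, f k * (q * dβ k B)) - ∑ l, h l * (p * dβ l B)) := by
  have hs : ∀ (f D : Fin 2 × Fin 2 → ℂ) (B : Fin 2),
      ∑ k, f k * (β B * D k) = β B * ∑ k, f k * D k := fun f D B => by
    rw [Finset.mul_sum]
    exact Finset.sum_congr rfl fun k _ => by ring
  simp only [mul_add, Finset.sum_add_distrib, hs, Fin.sum_univ_two, lower_zero, lower_one]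
  ring

end Algebra

variable {M : Type*} [TopologicalSpace M] [ChartedSpace (EuclideanSpace ℝ (Fin 4)) M]
  [IsManifold (𝓡 4) ∞ M]

namespace SpinStructure

variable {g : PseudoMetric M} {ι : Type*} (S : SpinStructure g ι) {i : ι} {x : M}
  {α β : ι → M → Fin 2 → ℂ} {K : ∀ x : M, CTangent x →ₗ[ℂ] CTangent x}

/-- The components `p^{A'} = φ⁻¹ α_B v^{BA'}` of the projection `β^A p^{A'}` of `v` to the
`+1`-eigenbundle. They do not change when a multiple of `α` is added to `β`. -/
def plusCoord (α β : ι → M → Fin 2 → ℂ) (i : ι) (x : M) (v : CTangent x) (A' : Fin 2) : ℂ :=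
  (contract (α i x) (β i x))⁻¹ * ∑ B, lower (α i x) B * S.coord i x v (B, A')

lemma plusCoord_deform (α β : ι → M → Fin 2 → ℂ) (ε : M → ℂ) (i : ι) (x : M) (v : CTangent x)
    (A' : Fin 2) :
    S.plusCoord α (deform α β ε) i x v A' = S.plusCoord α β i x v A' := by
  simp only [plusCoord, contract_deform]

lemma coord_projPlus (hK : S.Represents K α β) (hx : x ∈ S.U i)
    (hφ : contract (α i x) (β i x) ≠ 0) (X : ∀ x : M, CTangent x) (a : Fin 2 × Fin 2) :
    S.coord i x (projPlus K X x) a = β i x a.1 * S.plusCoord α β i x (X x) a.2 := by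
  rw [projPlus, ← coordLin_apply, map_smul, map_add, coordLin_apply, coordLin_apply,
    S.coord_of_represents hK hx, plusCoord]
  obtain ⟨A, A'⟩ := a
  simp only [contract_eq, lower_zero, lower_one, Fin.sum_univ_two, smul_eq_mul] at hφ ⊢
  fin_cases A <;>
  · simp only [Fin.zero_eta, Fin.mk_one]
    field_simp
    ring

lemma coord_projMinus (hK : S.Represents K α β) (hx : x ∈ S.U i)
    (hφ : contract (α i x) (β i x) ≠ 0) (X : ∀ x : M, CTangent x) (a : Fin 2 × Fin 2) :
    S.coord i x (projMinus K X x) a = -((contract (α i x) (β i x))⁻¹ * α i x a.1 *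
      ∑ B, lower (β i x) B * S.coord i x (X x) (B, a.2)) := by
  rw [projMinus, ← coordLin_apply, map_smul, map_add, map_neg, coordLin_apply, coordLin_apply,
    S.coord_of_represents hK hx]
  obtain ⟨A, A'⟩ := a
  simp only [contract_eq, lower_zero, lower_one, Fin.sum_univ_two, smul_eq_mul] at hφ ⊢
  fin_cases A <;>
  · simp only [Fin.zero_eta, Fin.mk_one]
    field_simp
    ring

/-- The coefficients `p^{A'}` of the projection of a differentiable field are differentiable. -/
lemma mdifferentiableAt_plusCoord (hα : S.IsSpinorField α) (hβ : S.IsSpinorField β)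
    (hφ : contract (α i x) (β i x) ≠ 0) (hx : x ∈ S.U i)
    {Z : ∀ x : M, CTangent x} (hZ : CDiffAt Z x) (A' : Fin 2) :
    MDifferentiableAt (𝓡 4) 𝓘(ℝ, ℂ) (fun y => S.plusCoord α β i y (Z y) A') x := by
  have dα := hα.mdifferentiableAt S hx
  have dβ := hβ.mdifferentiableAt S hx
  have dmul : ∀ {f h : M → ℂ}, MDifferentiableAt (𝓡 4) 𝓘(ℝ, ℂ) f x →
      MDifferentiableAt (𝓡 4) 𝓘(ℝ, ℂ) h x →
      MDifferentiableAt (𝓡 4) 𝓘(ℝ, ℂ) (fun y => f y * h y) x := fun h h' => h.mul h'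
  have dneg : ∀ {f : M → ℂ}, MDifferentiableAt (𝓡 4) 𝓘(ℝ, ℂ) f x →
      MDifferentiableAt (𝓡 4) 𝓘(ℝ, ℂ) (fun y => -f y) x := fun h => h.neg
  have dadd : ∀ {f h : M → ℂ}, MDifferentiableAt (𝓡 4) 𝓘(ℝ, ℂ) f x →
      MDifferentiableAt (𝓡 4) 𝓘(ℝ, ℂ) h x →
      MDifferentiableAt (𝓡 4) 𝓘(ℝ, ℂ) (fun y => f y + h y) x := fun h h' => h.add h'
  simp only [plusCoord, Fin.sum_univ_two, lower_zero, lower_one]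
  refine dmul (mdifferentiableAt_cinv ?_ (hφ))
    (dadd (dmul (dneg (dα 1)) (S.mdifferentiableAt_coord hx hZ _))
      (dmul (dα 0) (S.mdifferentiableAt_coord hx hZ _)))
  have hcon : (fun y => contract (α i y) (β i y)) =
      fun y => α i y 0 * β i y 1 + -(α i y 1 * β i y 0) := by
    funext y; rw [contract_eq]; ring
  rw [hcon]
  exact dadd (dmul (dα 0) (dβ 1)) (dneg (dmul (dα 1) (dβ 0)))

/-- The bracket of the projections of two fields to the `+1`-eigenbundle, in the tetrad. -/
lemma coord_cbracket_projPlus (hK : S.Represents K α β) (hα : S.IsSpinorField α)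
    (hβ : S.IsSpinorField β) (hφ : ∀ y ∈ S.U i, contract (α i y) (β i y) ≠ 0) (hx : x ∈ S.U i)
    {X Y : ∀ x : M, CTangent x} (hX : CDiffAt X x) (hY : CDiffAt Y x) (B A' : Fin 2) :
    S.coord i x (cbracket (projPlus K X) (projPlus K Y) x) (B, A') =
      (∑ k : Fin 2 × Fin 2, ∑ l : Fin 2 × Fin 2,
        β i x k.1 * S.plusCoord α β i x (X x) k.2 * (β i x l.1 * S.plusCoord α β i x (Y x) l.2) *
          ∑ c, eta (B, A') c * (S.conn i x k l c - S.conn i x l k c))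
      + (∑ k : Fin 2 × Fin 2, β i x k.1 * S.plusCoord α β i x (X x) k.2 *
          (β i x B * cderiv (fun y => S.plusCoord α β i y (Y y) A') x (S.e i k x)
            + S.plusCoord α β i x (Y x) A' * cderiv (fun y => β i y B) x (S.e i k x)))
      - ∑ l : Fin 2 × Fin 2, β i x l.1 * S.plusCoord α β i x (Y x) l.2 *
          (β i x B * cderiv (fun y => S.plusCoord α β i y (X y) A') x (S.e i l x)
            + S.plusCoord α β i x (X x) A' * cderiv (fun y => β i y B) x (S.e i l x)) := by
  have dβ := hβ.mdifferentiableAt S hx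
  have dX := S.mdifferentiableAt_plusCoord hα hβ (hφ x hx) hx hX
  have dY := S.mdifferentiableAt_plusCoord hα hβ (hφ x hx) hx hY
  let f : Fin 2 × Fin 2 → M → ℂ := fun a y => β i y a.1 * S.plusCoord α β i y (X y) a.2
  let h : Fin 2 × Fin 2 → M → ℂ := fun a y => β i y a.1 * S.plusCoord α β i y (Y y) a.2
  have df : ∀ a, MDifferentiableAt (𝓡 4) 𝓘(ℝ, ℂ) (f a) x := fun a => (dβ a.1).mul (dX a.2)
  have dh : ∀ a, MDifferentiableAt (𝓡 4) 𝓘(ℝ, ℂ) (h a) x := fun a => (dβ a.1).mul (dY a.2)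
  have hproj : ∀ Z : ∀ x : M, CTangent x, ∀ᶠ y in 𝓝 x, projPlus K Z y =
      ∑ a : Fin 2 × Fin 2, (β i y a.1 * S.plusCoord α β i y (Z y) a.2) • S.e i a y := by
    intro Z
    filter_upwards [(S.isOpen i).mem_nhds hx] with y hy
    rw [← S.sum_coord_smul_e hy (projPlus K Z y)]
    exact Finset.sum_congr rfl fun a _ => by rw [S.coord_projPlus hK hy (hφ y hy)]
  have hbr := (cbracket_congr (hproj X) (hproj Y)).trans
    (cbracket_sum_sum df dh (S.cdiffAt_e hx))
  have hf : ∀ v : CTangent x, cderiv (fun y => β i y B * S.plusCoord α β i y (X y) A') x v =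
      β i x B * cderiv (fun y => S.plusCoord α β i y (X y) A') x v
        + S.plusCoord α β i x (X x) A' * cderiv (fun y => β i y B) x v :=
    fun v => cderiv_mul (dβ B) (dX A') v
  have hh : ∀ v : CTangent x, cderiv (fun y => β i y B * S.plusCoord α β i y (Y y) A') x v =
      β i x B * cderiv (fun y => S.plusCoord α β i y (Y y) A') x v
        + S.plusCoord α β i x (Y x) A' * cderiv (fun y => β i y B) x v :=
    fun v => cderiv_mul (dβ B) (dY A') v
  rw [hbr]
  simp only [← coordLin_apply, map_add, map_sub, map_sum, map_smul]
  simp only [coordLin_apply, S.coord_e hx, S.coord_cbracket_e hx, smul_eq_mul,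
    mul_ite, mul_one, mul_zero, Finset.sum_ite_eq, Finset.mem_univ, if_true, hf, hh]

/-- The obstruction to involutivity of the `+1`-eigenbundle is given by the shear of `β`. -/
theorem coord_nijenhuisPlus (hK : S.Represents K α β) (hα : S.IsSpinorField α)
    (hβ : S.IsSpinorField β) (hφ : ∀ y ∈ S.U i, contract (α i y) (β i y) ≠ 0) (hx : x ∈ S.U i)
    {X Y : ∀ x : M, CTangent x} (hX : CDiffAt X x) (hY : CDiffAt Y x) (a : Fin 2 × Fin 2) :
    S.coord i x (nijenhuisPlus K X Y x) a =
      -((contract (α i x) (β i x))⁻¹ * α i x a.1 *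
        ((S.plusCoord α β i x (X x) 0 * S.plusCoord α β i x (Y x) 1
          - S.plusCoord α β i x (X x) 1 * S.plusCoord α β i x (Y x) 0) *
        ∑ B', eps a.2 B' * S.shear i (β i) B' x)) := by
  rw [nijenhuisPlus, S.coord_projMinus hK hx (hφ x hx)]
  simp only [S.coord_cbracket_projPlus hK hα hβ hφ hx hX hY]
  have e1 := lower_mul_derivative (β i x)
    (fun B => ∑ k : Fin 2 × Fin 2, ∑ l : Fin 2 × Fin 2,
      β i x k.1 * S.plusCoord α β i x (X x) k.2 * (β i x l.1 * S.plusCoord α β i x (Y x) l.2) *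
        ∑ c, eta (B, a.2) c * (S.conn i x k l c - S.conn i x l k c))
    (S.plusCoord α β i x (X x) a.2) (S.plusCoord α β i x (Y x) a.2)
    (fun k => β i x k.1 * S.plusCoord α β i x (X x) k.2)
    (fun k => β i x k.1 * S.plusCoord α β i x (Y x) k.2)
    (fun k => cderiv (fun y => S.plusCoord α β i y (X y) a.2) x (S.e i k x))
    (fun k => cderiv (fun y => S.plusCoord α β i y (Y y) a.2) x (S.e i k x))
    (fun k C => cderiv (fun y => β i y C) x (S.e i k x))
  have e2 := lower_mul_bracket (β := β i x)
    (dβ := fun a C => cderiv (fun y => β i y C) x (S.e i a x))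
    (p := S.plusCoord α β i x (X x)) (q := S.plusCoord α β i x (Y x))
    (S.conn_antisymm hx) a.2
  rw [e1, e2]
  rfl

/-- Global smooth sections of the `+1`-eigenbundle with prescribed value at a point, namely
`χ β^A o^{A'}` for a bump function `χ` supported in the domain of the spin frame. -/
lemma exists_section [T2Space M] (hK : S.Represents K α β) (hβ : S.IsSpinorField β)
    (hφ : ∀ y ∈ S.U i, contract (α i y) (β i y) ≠ 0) (hx : x ∈ S.U i) (A' : Fin 2) :
    ∃ X : ∀ x : M, CTangent x, SmoothOn X Set.univ ∧ (∀ y, K y (X y) = X y) ∧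
      ∀ B', S.plusCoord α β i x (X x) B' = if B' = A' then 1 else 0 := by
  obtain ⟨χ, -, hχ⟩ := (SmoothBumpFunction.nhds_basis_tsupport (I := 𝓡 4) x).mem_iff.1
    ((S.isOpen i).mem_nhds hx)
  let Z : ∀ y : M, CTangent y := fun y => ∑ A, β i y A • S.e i (A, A') y
  have hZ : ∀ y ∈ S.U i, ∀ a : Fin 2 × Fin 2,
      S.coord i y (Z y) a = β i y a.1 * if a.2 = A' then 1 else 0 := by
    rintro y hy ⟨B, B'⟩
    simp only [Z, ← coordLin_apply, map_sum, map_smul]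
    simp only [coordLin_apply, S.coord_e hy, smul_eq_mul, Prod.mk.injEq, Fin.sum_univ_two]
    fin_cases B <;> simp
  refine ⟨fun y => ((χ y : ℝ) : ℂ) • Z y, ?_, ?_, ?_⟩
  · have hre : ∀ A, ContMDiffOn (𝓡 4) 𝓘(ℝ, ℝ) ∞ (fun y => (β i y A).re) (S.U i) := fun A =>
      Complex.reCLM.contMDiff.comp_contMDiffOn (hβ.smooth i A)
    have him : ∀ A, ContMDiffOn (𝓡 4) 𝓘(ℝ, ℝ) ∞ (fun y => (β i y A).im) (S.U i) := fun A =>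
      Complex.imCLM.contMDiff.comp_contMDiffOn (hβ.smooth i A)
    have h1 : ContMDiffOn (𝓡 4) (𝓡 4).tangent ∞
        (fun y => (⟨y, (Z y).re⟩ : TangentBundle (𝓡 4) M)) (S.U i) := by
      simp only [Z, Fin.sum_univ_two]
      exact (((hre 0).smul_section (S.smooth_e i _).1).sub_section
        ((him 0).smul_section (S.smooth_e i _).2)).add_section
        (((hre 1).smul_section (S.smooth_e i _).1).sub_section
        ((him 1).smul_section (S.smooth_e i _).2))
    have h2 : ContMDiffOn (𝓡 4) (𝓡 4).tangent ∞
        (fun y => (⟨y, (Z y).im⟩ : TangentBundle (𝓡 4) M)) (S.U i) := by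
      simp only [Z, Fin.sum_univ_two]
      exact (((hre 0).smul_section (S.smooth_e i _).2).add_section
        ((him 0).smul_section (S.smooth_e i _).1)).add_section
        (((hre 1).smul_section (S.smooth_e i _).2).add_section
        ((him 1).smul_section (S.smooth_e i _).1))
    constructor
    · have := (ContMDiffOn.smul_section_of_tsupport χ.contMDiff.contMDiffOn (S.isOpen i) hχ
        h1).contMDiffOn (s := Set.univ)
      refine this.congr fun y _ => congrArg _ ?_
      change ((χ y : ℝ) : ℂ).re • (Z y).re - ((χ y : ℝ) : ℂ).im • (Z y).im = χ y • (Z y).re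
      rw [Complex.ofReal_re, Complex.ofReal_im, zero_smul, sub_zero]
    · have := (ContMDiffOn.smul_section_of_tsupport χ.contMDiff.contMDiffOn (S.isOpen i) hχ
        h2).contMDiffOn (s := Set.univ)
      refine this.congr fun y _ => congrArg _ ?_
      change ((χ y : ℝ) : ℂ).re • (Z y).im + ((χ y : ℝ) : ℂ).im • (Z y).re = χ y • (Z y).im
      rw [Complex.ofReal_re, Complex.ofReal_im, zero_smul, add_zero]
  · intro y
    rw [map_smul]
    by_cases hy : y ∈ S.U i
    · congr 1
      refine S.eq_of_coord_eq hy fun a => ?_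
      have hφy := hφ y hy
      simp only [S.coord_of_represents hK hy, hZ y hy, contract_eq, Fin.sum_univ_two, lower_zero,
        lower_one] at hφy ⊢
      field_simp
      ring
    · rw [image_eq_zero_of_notMem_tsupport fun h => hy (hχ h), Complex.ofReal_zero,
        zero_smul]
      change (0 : CTangent y) = ((χ y : ℝ) : ℂ) • Z y
      rw [image_eq_zero_of_notMem_tsupport fun h => hy (hχ h), Complex.ofReal_zero]
      exact (zero_smul ℂ (Z y)).symm
  · intro B'
    have hφx := hφ x hx
    simp only [χ.eq_one, Complex.ofReal_one, one_smul]
    simp only [plusCoord, hZ x hx, contract_eq, Fin.sum_univ_two, lower_zero, lower_one] at hφx ⊢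
    field_simp
    ring

omit [IsManifold (𝓡 4) ∞ M] in
lemma projPlus_of_mem {X : ∀ x : M, CTangent x} (hX : ∀ x, K x (X x) = X x) :
    projPlus K X = X := by
  funext x
  rw [projPlus, hX x]
  module

omit [IsManifold (𝓡 4) ∞ M] in
lemma projMinus_eq_zero_iff {Z : ∀ x : M, CTangent x} :
    projMinus K Z x = 0 ↔ K x (Z x) = Z x := by
  rw [projMinus, smul_eq_zero_iff_right (by norm_num), ← sub_eq_add_neg, sub_eq_zero, eq_comm]

/-- The obstruction vanishes at a point where the shear does. -/
lemma nijenhuisPlus_eq_zero (hK : S.Represents K α β) (hα : S.IsSpinorField α)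
    (hβ : S.IsSpinorField β) (hφ : ∀ y ∈ S.U i, contract (α i y) (β i y) ≠ 0) (hx : x ∈ S.U i)
    {X Y : ∀ x : M, CTangent x} (hX : CDiffAt X x) (hY : CDiffAt Y x)
    (hs : ∀ A', S.shear i (β i) A' x = 0) : nijenhuisPlus K X Y x = 0 := by
  refine S.eq_of_coord_eq hx fun a => ?_
  rw [S.coord_nijenhuisPlus hK hα hβ hφ hx hX hY, ← S.coordLin_apply a 0, map_zero]
  simp [hs]

/-- If `-φ⁻¹ α^A ε^{A'B'} s_{B'}` vanishes, so does `s`: the shear can be read off the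
obstruction. -/
lemma eq_zero_of_coord {α : Fin 2 → ℂ} {c : ℂ} (hc : c ≠ 0) (hα : ∃ A, α A ≠ 0) {s : Fin 2 → ℂ}
    (h : ∀ a : Fin 2 × Fin 2, -(c⁻¹ * α a.1 * ∑ B', eps a.2 B' * s B') = 0) (A' : Fin 2) :
    s A' = 0 := by
  obtain ⟨A, hA⟩ := hα
  have h0 := h (A, 0)
  have h1 := h (A, 1)
  simp [eps, hc, hA] at h0 h1
  fin_cases A'
  · exact h1
  · exact h0

lemma exists_ne_zero_of_contract {α β : Fin 2 → ℂ} (h : contract α β ≠ 0) : ∃ A, α A ≠ 0 := by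
  by_contra! h'
  exact h (by rw [contract_eq, h' 0, h' 1]; ring)

/-- The `+1`-eigenbundle is involutive if and only if `β` is shear-free. -/
theorem involutive_iff_shearFree [T2Space M] (hK : S.Represents K α β) (hα : S.IsSpinorField α)
    (hβ : S.IsSpinorField β) (hφ : ∀ i, ∀ y ∈ S.U i, contract (α i y) (β i y) ≠ 0) :
    Involutive K ↔ S.ShearFree β := by
  constructor
  · intro hinv i x hx
    obtain ⟨X, hX, hKX, hX'⟩ := S.exists_section hK hβ (hφ i) hx 0
    obtain ⟨Y, hY, hKY, hY'⟩ := S.exists_section hK hβ (hφ i) hx 1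
    have hN : nijenhuisPlus K X Y x = 0 := by
      rw [nijenhuisPlus, projPlus_of_mem hKX, projPlus_of_mem hKY, projMinus_eq_zero_iff]
      exact hinv X Y hX hY hKX hKY x
    refine eq_zero_of_coord (hφ i x hx) (exists_ne_zero_of_contract (hφ i x hx)) fun a => ?_
    have := S.coord_nijenhuisPlus hK hα hβ (hφ i) hx (hX.cdiffAt isOpen_univ trivial)
      (hY.cdiffAt isOpen_univ trivial) a
    rw [hN, ← coordLin_apply, map_zero] at this
    simpa [hX', hY'] using this.symm
  · intro hsf X Y hX hY hKX hKY x
    obtain ⟨i, hx⟩ := S.cover x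
    have hN := S.nijenhuisPlus_eq_zero hK hα hβ (hφ i) hx (hX.cdiffAt isOpen_univ trivial)
      (hY.cdiffAt isOpen_univ trivial) (hsf i x hx)
    rwa [nijenhuisPlus, projPlus_of_mem hKX, projPlus_of_mem hKY, projMinus_eq_zero_iff] at hN

end SpinStructure

end

section

/-! ### Families of scalar fields -/

/-- Symmetry of mixed partial derivatives, for one real variable and one vector variable. -/
lemma hasDerivAt_fderiv_swap {E : Type*} [NormedAddCommGroup E] [NormedSpace ℝ E]
    {G : ℝ × E → ℂ} {t₀ : ℝ} {y₀ : E} (hG : ContDiffAt ℝ 2 G (t₀, y₀)) :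
    DifferentiableAt ℝ (fun y => deriv (fun t => G (t, y)) t₀) y₀ ∧
    ∀ w, HasDerivAt (fun t => fderiv ℝ (fun y => G (t, y)) y₀ w)
      (fderiv ℝ (fun y => deriv (fun t => G (t, y)) t₀) y₀ w) t₀ := by
  have hdiff : ∀ᶠ p in 𝓝 (t₀, y₀), DifferentiableAt ℝ G p :=
    (hG.eventually (by simp)).mono fun p hp => hp.differentiableAt (by simp)
  have hD : HasFDerivAt (fderiv ℝ G) (fderiv ℝ (fderiv ℝ G) (t₀, y₀)) (t₀, y₀) :=
    ((hG.fderiv_right (m := 1) (by norm_num)).differentiableAt (by simp)).hasFDerivAt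
  have ct : Filter.Tendsto (fun t : ℝ => (t, y₀)) (𝓝 t₀) (𝓝 (t₀, y₀)) :=
    (Continuous.prodMk_left y₀).tendsto t₀
  have cy : Filter.Tendsto (fun y : E => (t₀, y)) (𝓝 y₀) (𝓝 (t₀, y₀)) :=
    (Continuous.prodMk_right t₀).tendsto y₀
  have ht : ∀ w, ∀ᶠ t in 𝓝 t₀, fderiv ℝ (fun y => G (t, y)) y₀ w = fderiv ℝ G (t, y₀) (0, w) := by
    intro w
    filter_upwards [ct.eventually hdiff] with t h
    have := (h.hasFDerivAt.comp y₀ (hasFDerivAt_prodMk_right t y₀)).fderiv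
    rw [show (fun y => G (t, y)) = G ∘ fun y => (t, y) from rfl, this]
    simp
  have hy : ∀ᶠ y in 𝓝 y₀, deriv (fun t => G (t, y)) t₀ = fderiv ℝ G (t₀, y) (1, 0) := by
    filter_upwards [cy.eventually hdiff] with y h
    have := (h.hasFDerivAt.comp t₀ (hasFDerivAt_prodMk_left t₀ y)).hasDerivAt.deriv
    rw [show (fun t => G (t, y)) = G ∘ fun t => (t, y) from rfl, this]
    simp
  have h1 : HasFDerivAt (fun y => fderiv ℝ G (t₀, y) (1, 0))
      (((fderiv ℝ (fderiv ℝ G) (t₀, y₀)).comp (ContinuousLinearMap.inr ℝ ℝ E)).flip (1, 0)) y₀ := by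
    have hc : HasFDerivAt (fun y => fderiv ℝ G (t₀, y)) ((fderiv ℝ (fderiv ℝ G) (t₀, y₀)).comp
      (ContinuousLinearMap.inr ℝ ℝ E)) y₀ := hD.comp y₀ (hasFDerivAt_prodMk_right t₀ y₀)
    refine (hc.clm_apply (hasFDerivAt_const ((1, 0) : ℝ × E) y₀)).congr_fderiv ?_
    ext w
    simp
  have h1' := h1.congr_of_eventuallyEq hy
  refine ⟨h1'.differentiableAt, fun w => ?_⟩
  have h2 : HasDerivAt (fun t => fderiv ℝ G (t, y₀) (0, w))
      (fderiv ℝ (fderiv ℝ G) (t₀, y₀) (1, 0) (0, w)) t₀ := by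
    have hc : HasFDerivAt (fun t => fderiv ℝ G (t, y₀)) ((fderiv ℝ (fderiv ℝ G) (t₀, y₀)).comp
      (ContinuousLinearMap.inl ℝ ℝ E)) t₀ := hD.comp t₀ (hasFDerivAt_prodMk_left t₀ y₀)
    exact ((hc.clm_apply (hasFDerivAt_const ((0, w) : ℝ × E) t₀)).hasDerivAt).congr_deriv
      (by simp)
  rw [h1'.fderiv]
  have hsymm := (hG.isSymmSndFDerivAt (by simp)) (1, 0) (0, w)
  exact (h2.congr_of_eventuallyEq (ht w)).congr_deriv (by simp [hsymm])

variable {M : Type*} [TopologicalSpace M] [ChartedSpace (EuclideanSpace ℝ (Fin 4)) M]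
  [IsManifold (𝓡 4) ∞ M]

/-- The `t`-derivative of a smooth family of functions commutes with directional derivatives. -/
lemma hasDerivAt_cderiv {ε : ℝ → M → ℂ}
    (hε : ContMDiff (𝓘(ℝ, ℝ).prod (𝓡 4)) 𝓘(ℝ, ℂ) ∞ (fun p : ℝ × M => ε p.1 p.2))
    (t₀ : ℝ) (x : M) (v : CTangent x) :
    HasDerivAt (fun t => cderiv (ε t) x v) (cderiv (fun y => deriv (fun t => ε t y) t₀) x v)
      t₀ := by
  let G : ℝ × EuclideanSpace ℝ (Fin 4) → ℂ := fun p => ε p.1 ((extChartAt (𝓡 4) x).symm p.2)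
  have hG : ContDiffAt ℝ 2 G (t₀, extChartAt (𝓡 4) x x) := by
    rw [← contMDiffAt_iff_contDiffAt]
    have h1 : ContMDiffAt (𝓡 4) (𝓡 4) 2 (extChartAt (𝓡 4) x).symm (extChartAt (𝓡 4) x x) :=
      (contMDiffOn_extChartAt_symm x).contMDiffAt (extChartAt_target_mem_nhds x)
    have h2 : ContMDiffAt 𝓘(ℝ, ℝ × EuclideanSpace ℝ (Fin 4)) (𝓘(ℝ, ℝ).prod (𝓡 4)) 2
        (fun p : ℝ × EuclideanSpace ℝ (Fin 4) => (p.1, (extChartAt (𝓡 4) x).symm p.2))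
        (t₀, extChartAt (𝓡 4) x x) :=
      (contDiff_fst.contMDiff.contMDiffAt).prodMk
        (ContMDiffAt.comp (t₀, extChartAt (𝓡 4) x x) h1 contDiff_snd.contMDiff.contMDiffAt)
    exact (hε.of_le (by norm_cast)).contMDiffAt.comp _ h2
  obtain ⟨hd, hw⟩ := hasDerivAt_fderiv_swap hG
  have hslice : ∀ t, MDifferentiableAt (𝓡 4) 𝓘(ℝ, ℂ) (ε t) x := fun t =>
    ((hε.comp (contMDiff_const.prodMk contMDiff_id : ContMDiff (𝓡 4) (𝓘(ℝ, ℝ).prod (𝓡 4)) ∞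
      fun y : M => (t, y))).contMDiffAt).mdifferentiableAt (by simp)
  have hder : MDifferentiableAt (𝓡 4) 𝓘(ℝ, ℂ) (fun y => deriv (fun t => ε t y) t₀) x := by
    have h1 := hd.mdifferentiableAt.comp x
      ((contMDiffAt_extChartAt (I := 𝓡 4) (n := 1) (x := x)).mdifferentiableAt one_ne_zero)
    refine h1.congr_of_eventuallyEq ?_
    filter_upwards [extChartAt_source_mem_nhds (I := 𝓡 4) x] with y hy
    simp only [G, Function.comp, (extChartAt (𝓡 4) x).left_inv hy]
  have hm : ∀ f : M → ℂ, MDifferentiableAt (𝓡 4) 𝓘(ℝ, ℂ) f x → ∀ w : TangentSpace (𝓡 4) x,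
      mvfderiv (𝓡 4) f x w =
        fderiv ℝ (fun y => f ((extChartAt (𝓡 4) x).symm y)) (extChartAt (𝓡 4) x x) w := by
    intro f hf w
    change (mfderiv (𝓡 4) 𝓘(ℝ, ℂ) f x) w = _
    simp only [mfderiv, hf, writtenInExtChartAt, ModelWithCorners.range_eq_univ,
      fderivWithin_univ]
    rfl
  simp only [cderiv_eq, hm _ (hslice _), hm _ hder]
  exact (hw v.re).add ((hw v.im).const_mul Complex.I)

/-! ### Involutivity to first order -/

section Topology

variable {V : Type*} [TopologicalSpace V]

lemma Cplx.isInducing : Topology.IsInducing fun X : Cplx V => (X.re, X.im) := ⟨rfl⟩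

instance [T2Space V] : T2Space (Cplx V) :=
  T2Space.of_injective_continuous (f := fun X : Cplx V => (X.re, X.im))
    (fun X Y h => by
      simp only [Prod.mk.injEq] at h
      exact Cplx.ext h.1 h.2) Cplx.isInducing.continuous

lemma Cplx.continuous_re : Continuous (Cplx.re : Cplx V → V) :=
  continuous_fst.comp Cplx.isInducing.continuous

lemma Cplx.continuous_im : Continuous (Cplx.im : Cplx V → V) :=
  continuous_snd.comp Cplx.isInducing.continuous

variable [AddCommGroup V] [IsTopologicalAddGroup V]

instance : ContinuousAdd (Cplx V) where
  continuous_add := Cplx.isInducing.continuous_iff.2 <|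
    ((Cplx.continuous_re.comp continuous_fst).add (Cplx.continuous_re.comp continuous_snd)).prodMk
    ((Cplx.continuous_im.comp continuous_fst).add (Cplx.continuous_im.comp continuous_snd))

instance [Module ℝ V] [ContinuousSMul ℝ V] : ContinuousSMul ℂ (Cplx V) where
  continuous_smul := Cplx.isInducing.continuous_iff.2 <|
    (((Complex.continuous_re.comp continuous_fst).smul
        (Cplx.continuous_re.comp continuous_snd)).sub
      ((Complex.continuous_im.comp continuous_fst).smul
        (Cplx.continuous_im.comp continuous_snd))).prodMk
    (((Complex.continuous_re.comp continuous_fst).smul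
        (Cplx.continuous_im.comp continuous_snd)).add
      ((Complex.continuous_im.comp continuous_fst).smul
        (Cplx.continuous_re.comp continuous_snd)))

end Topology

namespace SpinStructure

variable {g : PseudoMetric M} {ι : Type*} (S : SpinStructure g ι) {i : ι} {x : M}
  {α β : ι → M → Fin 2 → ℂ} {K : ∀ x : M, CTangent x →ₗ[ℂ] CTangent x}

/-- Convergence of complex tangent vectors follows from that of their components. -/
lemma tendsto_of_coord {κ : Type*} {l : Filter κ} (hx : x ∈ S.U i) {v : κ → CTangent x}
    {z : Fin 2 × Fin 2 → ℂ}
    (h : ∀ a, Filter.Tendsto (fun t => S.coord i x (v t) a) l (𝓝 (z a))) :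
    Filter.Tendsto v l (𝓝 (∑ a, z a • S.e i a x)) := by
  have : T2Space (TangentSpace (𝓡 4) x) := inferInstanceAs (T2Space (EuclideanSpace ℝ (Fin 4)))
  have h1 : v = fun t => ∑ a, S.coord i x (v t) a • S.e i a x := by
    funext t
    rw [S.sum_coord_smul_e hx]
  rw [h1]
  exact tendsto_finsetSum _ fun a _ => (h a).smul_const _

omit [IsManifold (𝓡 4) ∞ M] in
lemma smoothFun_slice {ε : ℝ → M → ℂ}
    (hε : ContMDiff (𝓘(ℝ, ℝ).prod (𝓡 4)) 𝓘(ℝ, ℂ) ∞ (fun p : ℝ × M => ε p.1 p.2)) (t : ℝ) :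
    SmoothFun (ε t) :=
  hε.comp (contMDiff_const.prodMk contMDiff_id : ContMDiff (𝓡 4) (𝓘(ℝ, ℝ).prod (𝓡 4)) ∞
    fun y : M => (t, y))

/-- The first-order variation of the shear along a family `β + ε_t α` with `ε_0 = 0`. -/
lemma hasDerivAt_shear_deform (hK : S.Represents K α β) (hα : S.IsSpinorField α)
    (hβ : S.IsSpinorField β) (hx : x ∈ S.U i) (hφ : contract (α i x) (β i x) ≠ 0)
    (w₀ w₁ : ℝ) {ε : ℝ → M → ℂ}
    (hε : ContMDiff (𝓘(ℝ, ℝ).prod (𝓡 4)) 𝓘(ℝ, ℂ) ∞ (fun p : ℝ × M => ε p.1 p.2))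
    (hε0 : ∀ x, ε 0 x = 0) (A' : Fin 2) :
    HasDerivAt (fun t => S.shear i (deform α β (ε t) i) A' x)
      (contract (α i x) (β i x) * S.weightedDerivβ K α β w₀ w₁ (-1) 1 (w₁ - w₀) i
        (fun y => deriv (fun t => ε t y) 0) A' x) 0 := by
  have ha : HasDerivAt (fun t => ε t x) (deriv (fun t => ε t x) 0) 0 := by
    have h : ContMDiff 𝓘(ℝ, ℝ) 𝓘(ℝ, ℂ) ∞ (fun t => ε t x) :=
      hε.comp (contMDiff_id.prodMk contMDiff_const : ContMDiff 𝓘(ℝ, ℝ) (𝓘(ℝ, ℝ).prod (𝓡 4)) ∞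
        fun t : ℝ => (t, x))
    exact ((contMDiff_iff_contDiff.1 h).differentiable (by simp) 0).hasDerivAt
  have hb := fun v : CTangent x => hasDerivAt_cderiv hε 0 x v
  have hsq : ∀ t (v : CTangent x),
      cderiv (fun y => ε t y ^ 2) x v = 2 * ε t x * cderiv (ε t) x v := by
    intro t v
    have dε : MDifferentiableAt (𝓡 4) 𝓘(ℝ, ℂ) (ε t) x :=
      (ContMDiff.contMDiffAt (smoothFun_slice hε t)).mdifferentiableAt (by simp)
    simp only [pow_two]
    rw [cderiv_mul dε dε]; ring
  have hb0 : ∀ v : CTangent x, cderiv (ε 0) x v = 0 := fun v => by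
    rw [show ε 0 = fun _ => 0 from funext hε0, cderiv_const]
  have h := fun t => S.shear_deform hK hα hβ hx hφ w₀ w₁ (smoothFun_slice hε t) A'
  simp only [h, weightedDerivβ, weightedDerivα, weightedDeriv, hsq, Fin.sum_univ_two]
  -- terms of second and third order in `ε` do not contribute, since `ε_0 = 0`
  have hlin : ∀ (v : CTangent x) (c : ℂ),
      HasDerivAt (fun t => cderiv (ε t) x v + c * ε t x)
        (cderiv (fun y => deriv (fun t => ε t y) 0) x v + c * deriv (fun t => ε t x) 0) 0 :=
    fun v c => (hb v).add (ha.const_mul c)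
  have hquad : ∀ (v : CTangent x) (c : ℂ),
      HasDerivAt (fun t => 2 * ε t x * cderiv (ε t) x v + c * ε t x ^ 2) 0 0 := by
    intro v c
    exact (((ha.const_mul 2).mul (hb v)).add ((ha.pow 2).const_mul c)).congr_deriv
      (by simp [hε0, hb0])
  have hcub : HasDerivAt (fun t => S.shear i (α i) A' x * ε t x ^ 3) 0 0 := by
    exact ((ha.pow 3).const_mul (S.shear i (α i) A' x)).congr_deriv (by simp [hε0])
  exact (((((((hlin _ _).const_mul _).add ((hlin _ _).const_mul _)).const_mul _).const_add
    _).add ((((hquad _ _).const_mul _).add ((hquad _ _).const_mul _)).const_mul _)).add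
      hcub).congr_deriv (by simp)

/-- If `β` is shear-free, the eigenbundles of the deformations are involutive to first order if
and only if the first-order part `ε̇` satisfies `C_{A'} ε̇ = 0`. -/
theorem involutiveToFirstOrder_iff [T2Space M] (hK : S.Represents K α β) (hα : S.IsSpinorField α)
    (hβ : S.IsSpinorField β) (hφ : ∀ i, ∀ y ∈ S.U i, contract (α i y) (β i y) ≠ 0)
    (w₀ w₁ : ℝ) (hsf : S.ShearFree β) {ε : ℝ → M → ℂ}
    (hε : ContMDiff (𝓘(ℝ, ℝ).prod (𝓡 4)) 𝓘(ℝ, ℂ) ∞ (fun p : ℝ × M => ε p.1 p.2))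
    (hε0 : ∀ x, ε 0 x = 0) {Kt : ℝ → ∀ x : M, CTangent x →ₗ[ℂ] CTangent x}
    (hKt : ∀ t, S.Represents (Kt t) α (deform α β (ε t))) :
    InvolutiveToFirstOrder Kt ↔ ∀ (i : ι), ∀ x ∈ S.U i, ∀ A' : Fin 2,
      S.weightedDerivβ K α β w₀ w₁ (-1) 1 (w₁ - w₀) i
        (fun y => deriv (fun t => ε t y) 0) A' x = 0 := by
  have hβt : ∀ t, S.IsSpinorField (deform α β (ε t)) := fun t =>
    hα.deform S hβ (smoothFun_slice hε t)
  have hφt : ∀ t i, ∀ y ∈ S.U i, contract (α i y) (deform α β (ε t) i y) ≠ 0 :=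
    fun t i y hy => by rw [contract_deform]; exact hφ i y hy
  have hdef0 : deform α β (ε 0) = β := by
    funext i x A
    simp [deform, hε0]
  have hslope : ∀ i, ∀ x ∈ S.U i, ∀ A', Filter.Tendsto
      (fun t : ℝ => ((t⁻¹ : ℝ) : ℂ) * S.shear i (deform α β (ε t) i) A' x) (𝓝[≠] 0)
      (𝓝 (contract (α i x) (β i x) * S.weightedDerivβ K α β w₀ w₁ (-1) 1 (w₁ - w₀) i
        (fun y => deriv (fun t => ε t y) 0) A' x)) := by
    intro i x hx A'
    have := hasDerivAt_iff_tendsto_slope_zero.1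
      (S.hasDerivAt_shear_deform hK hα hβ hx (hφ i x hx) w₀ w₁ hε hε0 A')
    refine this.congr fun t => ?_
    rw [zero_add, hdef0, hsf i x hx A', sub_zero, Complex.real_smul]
  -- the difference quotient of the obstruction converges to the first-order part of the shear
  have hlim : ∀ i, ∀ x ∈ S.U i, ∀ X Y : ∀ x : M, CTangent x, CDiffAt X x → CDiffAt Y x →
      Filter.Tendsto (fun t : ℝ => ((t⁻¹ : ℝ) : ℂ) • nijenhuisPlus (Kt t) X Y x) (𝓝[≠] 0)
        (𝓝 (∑ a : Fin 2 × Fin 2, -((contract (α i x) (β i x))⁻¹ * α i x a.1 *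
          ((S.plusCoord α β i x (X x) 0 * S.plusCoord α β i x (Y x) 1
            - S.plusCoord α β i x (X x) 1 * S.plusCoord α β i x (Y x) 0) *
          ∑ B', eps a.2 B' * (contract (α i x) (β i x) *
            S.weightedDerivβ K α β w₀ w₁ (-1) 1 (w₁ - w₀) i
              (fun y => deriv (fun t => ε t y) 0) B' x))) • S.e i a x)) := by
    intro i x hx X Y hX hY
    refine S.tendsto_of_coord hx fun a => ?_
    have h := (((((hslope i x hx 0).const_mul (eps a.2 0)).add
      ((hslope i x hx 1).const_mul (eps a.2 1))).const_mul
        (S.plusCoord α β i x (X x) 0 * S.plusCoord α β i x (Y x) 1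
            - S.plusCoord α β i x (X x) 1 * S.plusCoord α β i x (Y x) 0)).const_mul
        ((contract (α i x) (β i x))⁻¹ * α i x a.1)).neg
    rw [Fin.sum_univ_two]
    refine h.congr fun t => ?_
    rw [← coordLin_apply, map_smul, coordLin_apply,
      S.coord_nijenhuisPlus (hKt t) hα (hβt t) (hφt t i) hx hX hY, Fin.sum_univ_two, smul_eq_mul]
    simp only [plusCoord_deform, contract_deform]
    ring
  constructor
  · intro h i x hx
    obtain ⟨X, hX, -, hX'⟩ := S.exists_section hK hβ (hφ i) hx 0
    obtain ⟨Y, hY, -, hY'⟩ := S.exists_section hK hβ (hφ i) hx 1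
    have : T2Space (TangentSpace (𝓡 4) x) := inferInstanceAs (T2Space (EuclideanSpace ℝ (Fin 4)))
    have huniq := tendsto_nhds_unique (hlim i x hx X Y (hX.cdiffAt isOpen_univ trivial)
      (hY.cdiffAt isOpen_univ trivial)) (h X Y hX hY x).2
    intro A'
    refine (mul_eq_zero_iff_left (hφ i x hx)).1 ?_
    refine eq_zero_of_coord (s := fun A' => contract (α i x) (β i x) *
      S.weightedDerivβ K α β w₀ w₁ (-1) 1 (w₁ - w₀) i
        (fun y => deriv (fun t => ε t y) 0) A' x)
      (hφ i x hx) (exists_ne_zero_of_contract (hφ i x hx)) (fun a => ?_) A'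
    have := congrArg (fun v => S.coord i x v a) huniq
    simp only [S.coord_sum_e hx, hX', hY'] at this
    rw [← coordLin_apply, map_zero] at this
    simpa using this
  · intro h X Y hX hY x
    obtain ⟨i, hx⟩ := S.cover x
    have dX : CDiffAt X x := hX.cdiffAt isOpen_univ trivial
    have dY : CDiffAt Y x := hY.cdiffAt isOpen_univ trivial
    refine ⟨S.nijenhuisPlus_eq_zero (hKt 0) hα (hβt 0) (hφt 0 i) hx dX dY fun A' => ?_, ?_⟩
    · rw [hdef0]
      exact hsf i x hx A'
    · have := hlim i x hx X Y dX dY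
      simp only [h i x hx, mul_zero, Finset.sum_const_zero, neg_zero] at this
      simpa only [zero_smul, Finset.sum_const_zero] using this

end SpinStructure

end

end ParaHermitian

end

theorem mainTheorem11 {M : Type*} [TopologicalSpace M] [T2Space M]
    [ChartedSpace (EuclideanSpace ℝ (Fin 4)) M] [IsManifold (𝓡 4) ∞ M]
    (g : ParaHermitian.PseudoMetric M) {ι : Type*} (S : ParaHermitian.SpinStructure g ι)
    (α β : ι → M → Fin 2 → ℂ) (hα : S.IsSpinorField α) (hβ : S.IsSpinorField β)
    (hφ : ∀ (i : ι), ∀ x ∈ S.U i, ParaHermitian.contract (α i x) (β i x) ≠ 0)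
    (K : ∀ x : M, ParaHermitian.CTangent x →ₗ[ℂ] ParaHermitian.CTangent x)
    (hK : S.Represents K α β) (w₀ w₁ : ℝ) :
    -- the exact cubic identity for the shear of `β + ε α`
    (∀ ε : M → ℂ, ParaHermitian.SmoothFun ε → ∀ (i : ι), ∀ x ∈ S.U i, ∀ A' : Fin 2,
      S.shear i (ParaHermitian.deform α β ε i) A' x =
        S.shear i (β i) A' x
        + ParaHermitian.contract (α i x) (β i x) *
            S.weightedDerivβ K α β w₀ w₁ (-1) 1 (w₁ - w₀) i ε A' x
        + (1 / 2 : ℂ) * ParaHermitian.contract (α i x) (β i x) *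
            S.weightedDerivα K α β w₀ w₁ (-2) 2 (2 * (w₁ - w₀)) i (fun y => ε y ^ 2) A' x
        + S.shear i (α i) A' x * ε x ^ 3) ∧
    -- the deformed eigenbundle is involutive iff `β + ε α` is shear-free
    (∀ ε : M → ℂ, ParaHermitian.SmoothFun ε →
      ∀ Kε : ∀ x : M, ParaHermitian.CTangent x →ₗ[ℂ] ParaHermitian.CTangent x,
        S.Represents Kε α (ParaHermitian.deform α β ε) →
        (ParaHermitian.Involutive Kε ↔ S.ShearFree (ParaHermitian.deform α β ε))) ∧
    -- if `β` is shear-free, the deformed eigenbundle is involutive to first order iff `C_{A'} ε = 0`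
    (S.ShearFree β → ∀ ε : ℝ → M → ℂ,
      ContMDiff (𝓘(ℝ, ℝ).prod (𝓡 4)) 𝓘(ℝ, ℂ) ∞ (fun p : ℝ × M => ε p.1 p.2) →
      (∀ x, ε 0 x = 0) →
      ∀ Kt : ℝ → ∀ x : M, ParaHermitian.CTangent x →ₗ[ℂ] ParaHermitian.CTangent x,
        (∀ t, S.Represents (Kt t) α (ParaHermitian.deform α β (ε t))) →
        (ParaHermitian.InvolutiveToFirstOrder Kt ↔
          ∀ (i : ι), ∀ x ∈ S.U i, ∀ A' : Fin 2,
            S.weightedDerivβ K α β w₀ w₁ (-1) 1 (w₁ - w₀) i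
              (fun y => deriv (fun t => ε t y) 0) A' x = 0)) := by
  refine ⟨fun ε hε i x hx A' => S.shear_deform hK hα hβ hx (hφ i x hx) w₀ w₁ hε A',
    fun ε hε Kε hKε => S.involutive_iff_shearFree hKε hα (hα.deform S hβ hε) fun i x hx => ?_,
    fun hsf ε hε hε0 Kt hKt =>
      S.involutiveToFirstOrder_iff hK hα hβ hφ w₀ w₁ hsf hε hε0 hKt⟩
  rw [ParaHermitian.contract_deform]
  exact hφ i x hx
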